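/- **Setting.** A *flow network* is a connected, simple directed graph $G=(V,E)$ without pairs of reverse edges, with capacities $u:E\to\mathbb{R}_{\ge 0}$ and node budgets $b:V\to\mathbb{R}$. A *flow* is a function $f:E\to\mathbb{R}$ with $0\le f(e)\le u(e)$ for all $e$ and $b(v)+\sum_{e=(w,v)\in E}f(e)=\sum_{e=(v,w)\in E}f(e)$ for all $v$. In the smoothed model with parameter $\phi\ge 1$ an adversary fixes $G$, $u$, $b$ and, for every edge $e$, a probability density $g_e:[0,1]\to[0,\phi]$; the edge costs $c(e)$ are then drawn independently according to the densities $g_e$. A *spanning tree structure* is a partition of $E$ into sets $T,L,U$ with a flow $f$ such that $T$ is a spanning tree of the underlying undirected graph, $f=0$ on $L$ and $f=u$ on $U$. The Network Simplex (NS) algorithm starts with a spanning tree structure. It uses node potentials $\pi$ for which a given root has potential $0$ and the reduced cost $c(v,w)-\pi(v)+\pi(w)$ is $0$ for all $(v,w)\in T$. An edge violates its optimality condition if it is in $L$ and has negative reduced cost, or is in $U$ and has positive reduced cost. In each iteration a violating edge of maximum absolute reduced cost is added to $T$ (the most-negative-reduced-cost pivot rule), flow is augmented maximally along the resulting cycle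 (increasing the flow on the entering edge if it was in $L$, decreasing it if it was in $U$), and one of the edges that block further augmentation leaves $T$; if there are several such edges, the leaving edge is chosen by a tie-breaking rule. The algorithm stops when no edge violates its optimality condition. An iteration is *non-degenerate* if it changes the flow. **Theorem.** There are absolute constants $\alpha_1,\alpha_2,\beta_1,\beta_2,\kappa>0$ such that for all positive integers $n$, all integers $m\in\{n,\ldots,n^2\}$ and all real $\phi$ with $1\le\phi\le 2^n$ there exist a flow network $G=(V,E)$ with $\alpha_1 n\le|V|\le\alpha_2 n$ and $\beta_1 m\le|E|\le\beta_2 m$, densities $g_e:[0,1]\to[0,\phi]$ ($e\in E$), an initial spanning tree structure, and a tie-breaking rule for the leaving edge, none of them depending on the realized costs, such that with probability $1$ over the edge costs the NS algorithm terminates and makes at least $\kappa\cdot m\cdot\min\{n,\phi\}\cdot\phi$ non-degenerate iterations. -/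

import Mathlib

open MeasureTheory

noncomputable section

/-- A flow network with node set `V` and edge set `E`; edge `e` goes from `src e` to `tgt e`.
The directed graph is simple, has no pair of reverse edges, and is connected.
The budget is positive at nodes that offer the resource and negative at nodes that require it. -/
structure FlowNetwork (V E : Type) where
  src : E → V
  tgt : E → V
  cap : E → ℝ
  budget : V → ℝ
  no_loop : ∀ e, src e ≠ tgt e
  no_parallel : ∀ e e', src e = src e' → tgt e = tgt e' → e = e'
  no_reverse : ∀ e e', ¬ (src e = tgt e' ∧ tgt e = src e')
  cap_nonneg : ∀ e, 0 ≤ cap e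
  connected : (SimpleGraph.fromRel (fun u v => ∃ e, src e = u ∧ tgt e = v)).Connected

/-- The data `(T, L, U)` of a spanning tree structure together with its flow. -/
structure TreeStructure (E : Type) where
  T : Set E
  L : Set E
  U : Set E
  flow : E → ℝ

namespace FlowNetwork

variable {V E : Type} (G : FlowNetwork V E)

/-- The undirected graph on all nodes of the network formed by the edges in `T`. -/
def undirected (T : Set E) : SimpleGraph V :=
  SimpleGraph.fromRel (fun u v => ∃ e ∈ T, G.src e = u ∧ G.tgt e = v)

open scoped Classical in
/-- The total amount of `f` leaving node `v`. -/
def outflow [Fintype E] (f : E → ℝ) (v : V) : ℝ := ∑ e, if G.src e = v then f e else 0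

open scoped Classical in
/-- The total amount of `f` entering node `v`. -/
def inflow [Fintype E] (f : E → ℝ) (v : V) : ℝ := ∑ e, if G.tgt e = v then f e else 0

/-- `f` is a flow: it respects the capacities and conserves flow with respect to the budgets. -/
def IsFlow [Fintype E] (f : E → ℝ) : Prop :=
  (∀ e, 0 ≤ f e ∧ f e ≤ G.cap e) ∧ ∀ v, G.budget v + G.inflow f v = G.outflow f v

/-- `S = (T, L, U)` with its flow is a spanning tree structure: every edge belongs to exactly one
of `T`, `L`, `U`, the edges of `T` form a spanning tree, edges in `L` are empty and edges in `U`
are saturated. -/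
structure IsSpanningTreeStructure [Fintype E] (S : TreeStructure E) : Prop where
  cover : S.T ∪ S.L ∪ S.U = Set.univ
  disjoint_TL : Disjoint S.T S.L
  disjoint_TU : Disjoint S.T S.U
  disjoint_LU : Disjoint S.L S.U
  isTree : (G.undirected S.T).IsTree
  isFlow : G.IsFlow S.flow
  flow_L : ∀ e ∈ S.L, S.flow e = 0
  flow_U : ∀ e ∈ S.U, S.flow e = G.cap e

/-- The reduced cost of an edge for node potentials `π`. -/
def reducedCost (c : E → ℝ) (π : V → ℝ) (e : E) : ℝ := c e - π (G.src e) + π (G.tgt e)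

/-- `π` are the node potentials of the spanning tree `T` with root `r`: the potential of the root
is `0` and all tree edges have reduced cost `0`. -/
def IsTreePotential (c : E → ℝ) (r : V) (T : Set E) (π : V → ℝ) : Prop :=
  π r = 0 ∧ ∀ e ∈ T, G.reducedCost c π e = 0

/-- The edge `e` violates its optimality condition. -/
def Violates (c : E → ℝ) (π : V → ℝ) (S : TreeStructure E) (e : E) : Prop :=
  (e ∈ S.L ∧ G.reducedCost c π e < 0) ∨ (e ∈ S.U ∧ 0 < G.reducedCost c π e)

/-- `d` is the signed incidence vector of the unique cycle in `T ∪ {e}`, oriented such that flow is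
increased on `e` if `e ∈ L` and decreased on `e` if `e ∈ U`: `d` is `1` on cycle edges that are
traversed forward, `-1` on cycle edges that are traversed backward and `0` off the cycle.
(Since `T` is a spanning tree, there is exactly one circulation supported on `T ∪ {e}` with the
prescribed value at `e`.) -/
structure IsPivotCycle [Fintype E] (S : TreeStructure E) (e : E) (d : E → ℝ) : Prop where
  values : ∀ a, d a = -1 ∨ d a = 0 ∨ d a = 1
  support : ∀ a, d a ≠ 0 → a ∈ S.T ∪ {e}
  circulation : ∀ v, G.inflow d v = G.outflow d v
  entering_L : e ∈ S.L → d e = 1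
  entering_U : e ∈ S.U → d e = -1

open scoped Classical in
/-- How much the flow `f` can be changed on edge `a` in the direction given by `d`. -/
def residual (f d : E → ℝ) (a : E) : ℝ := if 0 < d a then G.cap a - f a else f a

/-- One iteration (pivot) of the Network Simplex algorithm from `S` to `S'` for edge costs `c`,
augmenting by `θ`. The entering edge has maximum absolute reduced cost among all edges that
violate their optimality condition. Flow is maximally augmented along the resulting cycle. Among
the blocking edges of the cycle, the leaving edge is selected by the rule `leave`; it moves
to `U` if it became saturated and to `L` if it became empty. -/
def Pivot [Fintype E] (c : E → ℝ) (r : V) (leave : Set E → E)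
    (S S' : TreeStructure E) (θ : ℝ) : Prop :=
  ∃ (π : V → ℝ) (e l : E) (d : E → ℝ),
    G.IsTreePotential c r S.T π ∧
    G.Violates c π S e ∧
    (∀ a, G.Violates c π S a → |G.reducedCost c π a| ≤ |G.reducedCost c π e|) ∧
    G.IsPivotCycle S e d ∧
    IsLeast {x | ∃ a, d a ≠ 0 ∧ x = G.residual S.flow d a} θ ∧
    l = leave {a | d a ≠ 0 ∧ G.residual S.flow d a = θ} ∧
    (∀ a, S'.flow a = S.flow a + θ * d a) ∧
    S'.T = (S.T ∪ {e}) \ {l} ∧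
    S'.L = (S.L \ {e}) ∪ {a | a = l ∧ d a < 0} ∧
    S'.U = (S.U \ {e}) ∪ {a | a = l ∧ 0 < d a}

/-- No edge violates its optimality condition, so the algorithm stops at `S`. -/
def IsFinal (c : E → ℝ) (r : V) (S : TreeStructure E) : Prop :=
  ∃ π : V → ℝ, G.IsTreePotential c r S.T π ∧ ∀ e, ¬ G.Violates c π S e

/-- `G.Execution c r leave S N S'`: finitely many iterations, exactly `N` of which are
non-degenerate, lead from `S` to `S'`. -/
inductive Execution [Fintype E] (c : E → ℝ) (r : V) (leave : Set E → E) (S : TreeStructure E) :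
    ℕ → TreeStructure E → Prop
  | start : Execution c r leave S 0 S
  | degenerate {N : ℕ} {S' S'' : TreeStructure E} :
      Execution c r leave S N S' → G.Pivot c r leave S' S'' 0 → Execution c r leave S N S''
  | nondegenerate {N : ℕ} {S' S'' : TreeStructure E} {θ : ℝ} :
      Execution c r leave S N S' → 0 < θ → G.Pivot c r leave S' S'' θ →
        Execution c r leave S (N + 1) S''

/-- Started at `S`, the Network Simplex algorithm needs at least `K` non-degenerate iterations:
there is no infinite execution, and every execution that cannot be continued has reached
a structure without violating edges and has made at least `K` non-degenerate iterations. -/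
def NeedsNondegenerate [Fintype E] (c : E → ℝ) (r : V) (leave : Set E → E)
    (S : TreeStructure E) (K : ℝ) : Prop :=
  (¬ ∃ s : ℕ → TreeStructure E, s 0 = S ∧ ∀ i, ∃ θ, G.Pivot c r leave (s i) (s (i + 1)) θ) ∧
  ∀ (N : ℕ) (S' : TreeStructure E), G.Execution c r leave S N S' →
    (¬ ∃ S'' θ, G.Pivot c r leave S' S'' θ) → G.IsFinal c r S' ∧ K ≤ (N : ℝ)

end FlowNetwork

/-- `g` is a probability density on `[0, 1]` that is bounded by `φ`. -/
structure IsCostDensity (φ : ℝ) (g : ℝ → ℝ) : Prop where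
  measurable : Measurable g
  nonneg : ∀ x, 0 ≤ g x
  le : ∀ x, g x ≤ φ
  eq_zero : ∀ x, x ∉ Set.Icc (0 : ℝ) 1 → g x = 0
  lintegral_eq_one : ∫⁻ x, ENNReal.ofReal (g x) = 1

/-- The law of the edge costs: independent draws, the cost of `e` having density `g e`. -/
def costLaw {E : Type} [Fintype E] (g : E → ℝ → ℝ) : Measure (E → ℝ) :=
  Measure.pi (fun e => volume.withDensity (fun x => ENNReal.ofReal (g e x)))

end

/-! On the networks built here, the pivot rule turns the algorithm into the parametric simplex
method in the cost of one edge `p`. Suppose that the current structure becomes optimal when the cost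
of `p` is shifted by some `y ≤ 0`. A violating cycle has negative cost, but nonnegative cost after
the shift, so it must use `p` backward. The most violating cycle, of cost `w`, is then the first to
become improving as the shift rises, and the structures before and after the pivot are both optimal
for the shift `w ≥ y` (`parametric_pivot`). As the shift rises, the optimal flow on `p` can only
fall, so the run cannot skip intermediate optima: of a family of optimal flows with distinct shifts
and distinct values on `p`, one iteration passes at most two, and a degenerate one passes none.
Hence a family of size `K` forces `K / 2` non-degenerate iterations
(`needsNondegenerate_of_family`).

It remains to find a two-terminal network with many optimal flow values as the price per unit
varies; `p` is a return edge from sink to source. A bipartite network with `m` middle edges has one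
value per middle edge (`base_isGadget`). Doubling adds a new source and sink, joined to the old ones
by cheap edges and, crosswise, by expensive paths. Low prices fill the old network; high prices use
the paths to cancel its flow again, so every old value yields two new ones (`IsGadget.double`).

Costs are uniform on intervals of length `φ⁻¹`, so all cost bounds hold surely. Almost surely the
costs satisfy no integer relation, which makes path costs distinct and rules out cycling. After `i`
doublings the prices are of order `2 ^ i / φ`; as an edge costs at most `1`, the next paths need
about `2 ^ i / φ` edges. Thus `O(n)` nodes allow `2 ^ D` of order `φ * min n φ`, with `2 ^ D * m`
values in total. -/

noncomputable section

/-! ### Spanning trees, potentials and cycle vectors by linear algebra -/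

theorem SimpleGraph.connected_fromRel_iff {V E : Type} [Nonempty V] {src tgt : E → V}
    (hloop : ∀ e, src e ≠ tgt e) (T : Set E) :
    (SimpleGraph.fromRel fun u v => ∃ e ∈ T, src e = u ∧ tgt e = v).Connected ↔
      ∀ π : V → ℝ, (∀ e ∈ T, π (src e) = π (tgt e)) → ∀ u v, π u = π v := by
  classical
  set H := SimpleGraph.fromRel fun u v => ∃ e ∈ T, src e = u ∧ tgt e = v with hH
  constructor
  · intro h π hπ u v
    obtain ⟨p⟩ := h.preconnected u v
    induction p with
    | nil => rfl
    | cons hadj _ ih =>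
      refine Eq.trans ?_ ih
      obtain ⟨-, ⟨e, he, rfl, rfl⟩ | ⟨e, he, rfl, rfl⟩⟩ := (SimpleGraph.fromRel_adj _ _ _).1 hadj
      · exact hπ e he
      · exact (hπ e he).symm
  · intro h
    refine ⟨fun u v => ?_⟩
    -- The indicator of the component of `u` agrees at both ends of every edge of `T`, so it is
    -- constant.
    have key := h (fun w => if H.Reachable u w then 1 else 0) ?_ u v
    · by_contra hc
      simp [hc] at key
    · intro e he
      have hadj : H.Adj (src e) (tgt e) :=
        (SimpleGraph.fromRel_adj _ _ _).2 ⟨hloop e, Or.inl ⟨e, he, rfl, rfl⟩⟩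
      have : H.Reachable u (src e) ↔ H.Reachable u (tgt e) :=
        ⟨fun h => h.trans hadj.reachable, fun h => h.trans hadj.symm.reachable⟩
      simp only [this]

namespace FlowNetwork

variable {V E : Type} (G : FlowNetwork V E)

/-- `T` connects all nodes, stated in terms of potentials. -/
def Spans (T : Set E) : Prop :=
  ∀ π : V → ℝ, (∀ e ∈ T, π (G.src e) = π (G.tgt e)) → ∀ u v, π u = π v

theorem undirected_connected_iff [Nonempty V] (T : Set E) :
    (G.undirected T).Connected ↔ G.Spans T :=
  SimpleGraph.connected_fromRel_iff G.no_loop T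

theorem sym2_endpoints_injective : Function.Injective (fun e => s(G.src e, G.tgt e)) := by
  intro e e' h
  rcases Sym2.eq_iff.1 h with h | h
  · exact G.no_parallel _ _ h.1 h.2
  · exact absurd h (G.no_reverse _ _)

theorem card_edgeSet_undirected (T : Set E) :
    Nat.card (G.undirected T).edgeSet = T.ncard := by
  have : (G.undirected T).edgeSet = (fun e => s(G.src e, G.tgt e)) '' T := by
    ext z
    induction z with | _ u v
    simp only [SimpleGraph.mem_edgeSet, undirected, SimpleGraph.fromRel_adj, Set.mem_image,
      Sym2.eq_iff]
    constructor
    · rintro ⟨-, ⟨e, he, rfl, rfl⟩ | ⟨e, he, rfl, rfl⟩⟩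
      · exact ⟨e, he, by simp⟩
      · exact ⟨e, he, by simp⟩
    · rintro ⟨e, he, ⟨rfl, rfl⟩ | ⟨rfl, rfl⟩⟩
      · exact ⟨G.no_loop e, Or.inl ⟨e, he, rfl, rfl⟩⟩
      · exact ⟨(G.no_loop e).symm, Or.inr ⟨e, he, rfl, rfl⟩⟩
  rw [this, Nat.card_coe_set_eq, Set.ncard_image_of_injective _ G.sym2_endpoints_injective]

theorem isTree_iff_spans [Fintype V] [Nonempty V] (T : Set E) :
    (G.undirected T).IsTree ↔ G.Spans T ∧ T.ncard + 1 = Fintype.card V := by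
  rw [SimpleGraph.isTree_iff_connected_and_card, undirected_connected_iff,
    card_edgeSet_undirected, Nat.card_eq_fintype_card]

theorem isTree_iff [Fintype V] (r : V) (T : Set E) :
    (G.undirected T).IsTree ↔ G.Spans T ∧ T.ncard + 1 = Fintype.card V :=
  have : Nonempty V := ⟨r⟩
  G.isTree_iff_spans T

variable [Fintype E]

theorem sum_potential_mul_excess [Fintype V] (d : E → ℝ) (π : V → ℝ) :
    ∑ v, π v * (G.outflow d v - G.inflow d v) = ∑ e, d e * (π (G.src e) - π (G.tgt e)) := by
  classical
  simp only [outflow, inflow, mul_sub, Finset.sum_sub_distrib, Finset.mul_sum]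
  rw [Finset.sum_comm]
  congr 1
  · refine Finset.sum_congr rfl fun e _ => ?_
    simp [mul_comm]
  · rw [Finset.sum_comm]
    refine Finset.sum_congr rfl fun e _ => ?_
    simp [mul_comm]

/-- Circulations are the vectors orthogonal to all potential differences; unit potentials recover
conservation at a single node. In this form later arguments need no walks around cycles. -/
theorem circulation_iff [Fintype V] (d : E → ℝ) :
    (∀ v, G.inflow d v = G.outflow d v) ↔
      ∀ π : V → ℝ, ∑ e, d e * (π (G.src e) - π (G.tgt e)) = 0 := by
  classical
  constructor
  · intro h π
    rw [← sum_potential_mul_excess]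
    simp [h]
  · intro h v
    have := h (Pi.single v 1)
    rw [← sum_potential_mul_excess] at this
    simp [Pi.single_apply] at this
    linarith

theorem sum_mul_reducedCost [Fintype V] {d : E → ℝ} (hd : ∀ v, G.inflow d v = G.outflow d v)
    (c : E → ℝ) (π : V → ℝ) : ∑ a, d a * G.reducedCost c π a = ∑ a, d a * c a := by
  have h := (G.circulation_iff d).1 hd π
  have : ∑ a, d a * G.reducedCost c π a
      = ∑ a, d a * c a - ∑ e, d e * (π (G.src e) - π (G.tgt e)) := by
    rw [← Finset.sum_sub_distrib]
    refine Finset.sum_congr rfl fun e _ => ?_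
    simp only [reducedCost]
    ring
  rw [this, h, sub_zero]

/-- The linear map from potentials to their differences along `T` and their value at `r` is
injective because `T` spans, and it is bijective because `T` has one edge fewer than there are
nodes. -/
theorem exists_treePotential [Fintype V] {T : Set E} (hT : (G.undirected T).IsTree)
    (c : E → ℝ) (r : V) : ∃ π, G.IsTreePotential c r T π := by
  classical
  obtain ⟨hs, hc⟩ := (G.isTree_iff r T).1 hT
  let A : (V → ℝ) →ₗ[ℝ] (T → ℝ) × ℝ :=
    { toFun := fun π => (fun e => π (G.src e) - π (G.tgt e), π r)
      map_add' := by
        intro x y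
        ext <;> simp
        ring
      map_smul' := by
        intro k x
        ext <;> simp
        ring }
  have hfin : Module.finrank ℝ (V → ℝ) = Module.finrank ℝ ((T → ℝ) × ℝ) := by
    rw [Module.finrank_prod, Module.finrank_fintype_fun_eq_card, Module.finrank_fintype_fun_eq_card,
      Module.finrank_self, ← hc, ← Nat.card_coe_set_eq, Nat.card_eq_fintype_card]
  have hinj : Function.Injective A := by
    rw [← LinearMap.ker_eq_bot, LinearMap.ker_eq_bot']
    intro π hπ
    have h1 : ∀ e ∈ T, π (G.src e) = π (G.tgt e) := fun e he =>
      sub_eq_zero.1 (congrFun (congrArg Prod.fst hπ) ⟨e, he⟩)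
    have h2 : π r = 0 := congrArg Prod.snd hπ
    ext v
    rw [hs π h1 v r, h2]
    rfl
  obtain ⟨π, hπ⟩ := (LinearMap.injective_iff_surjective_of_finrank_eq_finrank hfin).1 hinj
    (fun e => c e, 0)
  refine ⟨π, congrArg Prod.snd hπ, fun e he => ?_⟩
  have : π (G.src e) - π (G.tgt e) = c e := congrFun (congrArg Prod.fst hπ) ⟨e, he⟩
  simp only [reducedCost]
  linarith

/-- Signed incidence vector of a path. The support clause carries the induction: an edge at a node
that the rest of the path avoids has value `0` so far, so adding it keeps all values in `{-1, 0,
1}`. -/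
theorem exists_pathVector [Fintype V] {T : Set E} {u v : V} (p : (G.undirected T).Walk u v)
    (hp : p.IsPath) : ∃ χ : E → ℝ, (∀ a, χ a = -1 ∨ χ a = 0 ∨ χ a = 1) ∧
      (∀ a, χ a ≠ 0 → a ∈ T ∧ G.src a ∈ p.support ∧ G.tgt a ∈ p.support) ∧
      ∀ π : V → ℝ, ∑ a, χ a * (π (G.src a) - π (G.tgt a)) = π u - π v := by
  classical
  induction p with
  | nil => exact ⟨0, by simp, by simp, by simp⟩
  | @cons u w v hadj q ih =>
    rw [SimpleGraph.Walk.cons_isPath_iff] at hp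
    obtain ⟨χ, h1, h2, h3⟩ := ih hp.1
    obtain ⟨-, ⟨e, he, rfl, rfl⟩ | ⟨e, he, rfl, rfl⟩⟩ := (SimpleGraph.fromRel_adj _ _ _).1 hadj
    · have he0 : χ e = 0 := by
        by_contra h
        exact hp.2 (h2 e h).2.1
      refine ⟨χ + Pi.single e 1, fun a => ?_, fun a ha => ?_, fun π => ?_⟩
      · by_cases hae : a = e
        · subst hae; simp [he0]
        · simpa [hae] using h1 a
      · by_cases hae : a = e
        · subst hae; simp [he]
        · have := h2 a (by simpa [hae] using ha)
          simp [this]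
      · simp only [Pi.add_apply, add_mul, Finset.sum_add_distrib, h3 π]
        simp [Pi.single_apply]
    · have he0 : χ e = 0 := by
        by_contra h
        exact hp.2 (h2 e h).2.2
      refine ⟨χ - Pi.single e 1, fun a => ?_, fun a ha => ?_, fun π => ?_⟩
      · by_cases hae : a = e
        · subst hae; simp [he0]
        · simpa [hae] using h1 a
      · by_cases hae : a = e
        · subst hae; simp [he]
        · have := h2 a (by simpa [hae] using ha)
          simp [this]
      · simp only [Pi.sub_apply, sub_mul, Finset.sum_sub_distrib, h3 π]
        simp [Pi.single_apply]

theorem exists_isPivotCycle [Fintype V] {S : TreeStructure E} (hT : (G.undirected S.T).IsTree)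
    (hLU : Disjoint S.L S.U) {e : E} (he : e ∉ S.T) : ∃ d, G.IsPivotCycle S e d := by
  classical
  obtain ⟨p, hp⟩ := hT.1.exists_isPath (G.tgt e) (G.src e)
  obtain ⟨χ, h1, h2, h3⟩ := G.exists_pathVector p hp
  have he0 : χ e = 0 := by
    by_contra h
    exact he (h2 e h).1
  have hcirc : ∀ π : V → ℝ,
      ∑ a, (χ + Pi.single e 1 : E → ℝ) a * (π (G.src a) - π (G.tgt a)) = 0 := by
    intro π
    simp only [Pi.add_apply, add_mul, Finset.sum_add_distrib, h3 π]
    simp [Pi.single_apply]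
  have hval : ∀ a, (χ + Pi.single e 1 : E → ℝ) a = -1 ∨ (χ + Pi.single e 1 : E → ℝ) a = 0 ∨
      (χ + Pi.single e 1 : E → ℝ) a = 1 := by
    intro a
    by_cases hae : a = e
    · subst hae; simp [he0]
    · simpa [hae] using h1 a
  have hsup : ∀ a, (χ + Pi.single e 1 : E → ℝ) a ≠ 0 → a ∈ S.T ∪ {e} := by
    intro a ha
    by_cases hae : a = e
    · simp [hae]
    · exact Or.inl (h2 a (by simpa [hae] using ha)).1
  by_cases heU : e ∈ S.U
  · refine ⟨-(χ + Pi.single e 1), ⟨fun a => ?_, fun a ha => hsup a (neg_ne_zero.1 ha), ?_, ?_, ?_⟩⟩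
    · rcases hval a with h | h | h <;> simp only [Pi.neg_apply, h] <;> simp
    · rw [circulation_iff]
      intro π
      simpa only [Pi.neg_apply, neg_mul, Finset.sum_neg_distrib, neg_eq_zero] using hcirc π
    · intro h
      exact absurd heU (Set.disjoint_left.1 hLU h)
    · intro _
      simp [he0]
  · refine ⟨χ + Pi.single e 1, ⟨hval, hsup, ?_, ?_, fun h => absurd h heU⟩⟩
    · rw [circulation_iff]
      exact hcirc
    · intro _
      simp [he0]

end FlowNetwork

/-! ### Pivots: invariance of spanning tree structures, and cycle costs -/

namespace FlowNetwork

theorem exchange_partition {E : Type} {T L U : Set E} (hcov : T ∪ L ∪ U = Set.univ) (hTL : Disjoint T L)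
    (hTU : Disjoint T U) (hLU : Disjoint L U) {d : E → ℝ} {e l : E} (hl : l ∈ T ∪ {e})
    (hd : d l < 0 ∨ 0 < d l) :
    ((T ∪ {e}) \ {l}) ∪ ((L \ {e}) ∪ {a | a = l ∧ d a < 0}) ∪
      ((U \ {e}) ∪ {a | a = l ∧ 0 < d a}) = Set.univ ∧
    Disjoint ((T ∪ {e}) \ {l}) ((L \ {e}) ∪ {a | a = l ∧ d a < 0}) ∧
    Disjoint ((T ∪ {e}) \ {l}) ((U \ {e}) ∪ {a | a = l ∧ 0 < d a}) ∧
    Disjoint ((L \ {e}) ∪ {a | a = l ∧ d a < 0}) ((U \ {e}) ∪ {a | a = l ∧ 0 < d a}) := by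
  rw [Set.disjoint_left] at *
  simp only [Set.eq_univ_iff_forall, Set.mem_union, Set.mem_sdiff, Set.mem_singleton_iff,
    Set.mem_ofPred_eq, Set.disjoint_left] at *
  refine ⟨fun a => ?_, fun a ha hb => ?_, fun a ha hb => ?_, fun a ha hb => ?_⟩
  · have := hcov a
    by_cases hal : a = l
    · subst hal; tauto
    · tauto
  · have := @hTL a
    tauto
  · have := @hTU a
    tauto
  · have h1 := @hLU a
    have h2 := @hTL a
    have h3 := @hTU a
    by_cases hal : a = l
    · subst hal
      have h4 : ¬ (d a < 0 ∧ 0 < d a) := fun h => lt_asymm h.1 h.2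
      tauto
    · tauto

variable {V E : Type} (G : FlowNetwork V E) [Fintype E]

variable {G} in
theorem Violates.notMem_T {c : E → ℝ} {π : V → ℝ} {S : TreeStructure E}
    (hS : G.IsSpanningTreeStructure S) {e : E} (he : G.Violates c π S e) : e ∉ S.T := by
  intro h
  rcases he with he | he
  · exact Set.disjoint_left.1 hS.disjoint_TL h he.1
  · exact Set.disjoint_left.1 hS.disjoint_TU h he.1

variable {G} in
theorem IsPivotCycle.ne_zero {c : E → ℝ} {π : V → ℝ} {S : TreeStructure E} {e : E}
    {d : E → ℝ} (hd : G.IsPivotCycle S e d) (he : G.Violates c π S e) : d e ≠ 0 := by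
  rcases he with he | he
  · simp [hd.entering_L he.1]
  · simp [hd.entering_U he.1]

/-- The cost of a pivot cycle is the signed reduced cost of the entering edge. -/
theorem cost_pivotCycle [Fintype V] {c : E → ℝ} {r : V} {π : V → ℝ} {S : TreeStructure E} {e : E}
    {d : E → ℝ} (hπ : G.IsTreePotential c r S.T π) (hd : G.IsPivotCycle S e d) :
    ∑ a, d a * c a = d e * G.reducedCost c π e := by
  classical
  rw [← G.sum_mul_reducedCost hd.circulation c π]
  refine Finset.sum_eq_single e (fun a _ hae => ?_) (by simp)
  by_cases ha : d a = 0
  · simp [ha]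
  · rcases hd.support a ha with h | h
    · rw [hπ.2 a h, mul_zero]
    · exact absurd h hae

theorem cost_pivotCycle_of_violates [Fintype V] {c : E → ℝ} {r : V} {π : V → ℝ}
    {S : TreeStructure E} {e : E} {d : E → ℝ} (hπ : G.IsTreePotential c r S.T π)
    (hd : G.IsPivotCycle S e d) (he : G.Violates c π S e) :
    ∑ a, d a * c a = -|G.reducedCost c π e| := by
  rw [G.cost_pivotCycle hπ hd]
  rcases he with he | he
  · rw [hd.entering_L he.1, abs_of_neg he.2]; ring
  · rw [hd.entering_U he.1, abs_of_pos he.2]; ring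

theorem cost_pivotCycle_nonneg [Fintype V] {c : E → ℝ} {r : V} {π : V → ℝ}
    {S : TreeStructure E} {e : E} {d : E → ℝ} (hS : G.IsSpanningTreeStructure S)
    (hπ : G.IsTreePotential c r S.T π) (hd : G.IsPivotCycle S e d) (he : e ∉ S.T)
    (hv : ¬ G.Violates c π S e) : 0 ≤ ∑ a, d a * c a := by
  rw [G.cost_pivotCycle hπ hd]
  have hcov : e ∈ S.T ∪ S.L ∪ S.U := hS.cover ▸ Set.mem_univ e
  simp only [Violates, not_or, not_and, not_lt] at hv
  rcases hcov with (h | h) | h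
  · exact absurd h he
  · rw [hd.entering_L h]; linarith [hv.1 h]
  · rw [hd.entering_U h]; linarith [hv.2 h]

/-- Optimality in terms of cycle costs only. Cycle costs respond to a shift of one edge cost in an
obvious way, whereas tree potentials do not. -/
theorem isFinal_of_cost_nonneg [Fintype V] {c : E → ℝ} {r : V} {S : TreeStructure E}
    (hS : G.IsSpanningTreeStructure S)
    (h : ∀ e d, e ∉ S.T → G.IsPivotCycle S e d → 0 ≤ ∑ a, d a * c a) : G.IsFinal c r S := by
  obtain ⟨π, hπ⟩ := G.exists_treePotential hS.isTree c r
  refine ⟨π, hπ, fun e he => ?_⟩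
  obtain ⟨d, hd⟩ := G.exists_isPivotCycle hS.isTree hS.disjoint_LU (he.notMem_T hS)
  have h0 := h e d (he.notMem_T hS) hd
  rw [G.cost_pivotCycle_of_violates hπ hd he] at h0
  have : G.reducedCost c π e ≠ 0 := by
    rcases he with he | he
    · exact he.2.ne
    · exact he.2.ne'
  have := abs_pos.2 this
  linarith

theorem inflow_add_smul (f d : E → ℝ) (θ : ℝ) (v : V) :
    G.inflow (fun a => f a + θ * d a) v = G.inflow f v + θ * G.inflow d v := by
  simp only [inflow, Finset.mul_sum, ← Finset.sum_add_distrib]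
  refine Finset.sum_congr rfl fun e _ => ?_
  split_ifs <;> simp

theorem outflow_add_smul (f d : E → ℝ) (θ : ℝ) (v : V) :
    G.outflow (fun a => f a + θ * d a) v = G.outflow f v + θ * G.outflow d v := by
  simp only [outflow, Finset.mul_sum, ← Finset.sum_add_distrib]
  refine Finset.sum_congr rfl fun e _ => ?_
  split_ifs <;> simp

theorem residual_nonneg {f : E → ℝ} (hf : G.IsFlow f) (d : E → ℝ) (a : E) :
    0 ≤ G.residual f d a := by
  unfold residual
  split_ifs
  · linarith [(hf.1 a).2]
  · exact (hf.1 a).1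

theorem isFlow_augment {f d : E → ℝ} (hf : G.IsFlow f)
    (hval : ∀ a, d a = -1 ∨ d a = 0 ∨ d a = 1) (hd : ∀ v, G.inflow d v = G.outflow d v) {θ : ℝ}
    (h0 : 0 ≤ θ) (hθ : ∀ a, d a ≠ 0 → θ ≤ G.residual f d a) :
    G.IsFlow (fun a => f a + θ * d a) := by
  refine ⟨fun a => ?_, fun v => ?_⟩
  · change 0 ≤ f a + θ * d a ∧ f a + θ * d a ≤ G.cap a
    have h1 := hf.1 a
    have h2 := hθ a
    unfold residual at h2
    rcases hval a with h | h | h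
    · have := h2 (by rw [h]; norm_num)
      rw [h, if_neg (by norm_num)] at this
      rw [h]
      constructor <;> linarith
    · rw [h]
      constructor <;> linarith
    · have := h2 (by rw [h]; norm_num)
      rw [h, if_pos (by norm_num)] at this
      rw [h]
      constructor <;> linarith
  · rw [inflow_add_smul, outflow_add_smul, hd v, ← hf.2 v]
    ring

/-- If `π` agrees across all edges of the new tree, orthogonality of the circulation `d` to its
differences leaves only the term of `l`, so `π` agrees across `l` as well. -/
theorem Spans.exchange [Fintype V] {T : Set E} (hT : G.Spans T) {e l : E} {d : E → ℝ}
    (hd : ∀ v, G.inflow d v = G.outflow d v) (hsup : ∀ a, d a ≠ 0 → a ∈ T ∪ {e})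
    (hl : d l ≠ 0) : G.Spans ((T ∪ {e}) \ {l}) := by
  intro π hπ
  have h0 := (G.circulation_iff d).1 hd π
  have hsum : ∑ a, d a * (π (G.src a) - π (G.tgt a)) = d l * (π (G.src l) - π (G.tgt l)) := by
    refine Finset.sum_eq_single l (fun a _ hal => ?_) (by simp)
    by_cases ha : d a = 0
    · simp [ha]
    · rw [hπ a ⟨hsup a ha, hal⟩]; ring
  rw [hsum] at h0
  have hl' : π (G.src l) = π (G.tgt l) := by
    rcases mul_eq_zero.1 h0 with h | h
    · exact absurd h hl
    · linarith
  refine hT π fun a ha => ?_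
  by_cases hal : a = l
  · rw [hal, hl']
  · exact hπ a ⟨Or.inl ha, hal⟩

variable {G} in
theorem Pivot.isSpanningTreeStructure [Fintype V] {c : E → ℝ} {r : V} {leave : Set E → E}
    (hleave : ∀ A : Set E, A.Nonempty → leave A ∈ A) {S S' : TreeStructure E} {θ : ℝ}
    (hS : G.IsSpanningTreeStructure S) (hp : G.Pivot c r leave S S' θ) :
    G.IsSpanningTreeStructure S' := by
  classical
  obtain ⟨π, e, l, d, hπ, he, -, hd, ⟨⟨a₀, ha₀, hθ⟩, hmin⟩, hl, hflow, hT, hL, hU⟩ := hp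
  obtain ⟨hl0, hlθ⟩ : d l ≠ 0 ∧ G.residual S.flow d l = θ := by
    rw [hl]
    exact hleave {a | d a ≠ 0 ∧ G.residual S.flow d a = θ} ⟨a₀, ha₀, hθ.symm⟩
  have heT := he.notMem_T hS
  have hl1 : d l < 0 ∨ 0 < d l := lt_or_gt_of_ne hl0
  have hlTe := hd.support l hl0
  have hTL := Set.disjoint_left.1 hS.disjoint_TL
  have hTU := Set.disjoint_left.1 hS.disjoint_TU
  have hθ0 : 0 ≤ θ := hθ ▸ G.residual_nonneg hS.isFlow d a₀
  have hflow' : S'.flow = fun a => S.flow a + θ * d a := funext hflow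
  have hd0 : ∀ a, a ∉ S.T → a ≠ e → d a = 0 := fun a h1 h2 => by
    by_contra h
    rcases hd.support a h with h | h
    · exact h1 h
    · exact h2 h
  obtain ⟨k1, k2, k3, k4⟩ := exchange_partition hS.cover hS.disjoint_TL hS.disjoint_TU
    hS.disjoint_LU hlTe hl1
  refine ⟨by rw [hT, hL, hU, k1], by rw [hT, hL]; exact k2, by rw [hT, hU]; exact k3,
    by rw [hL, hU]; exact k4, ?_, ?_, ?_, ?_⟩
  · obtain ⟨h1, h2⟩ := (G.isTree_iff r S.T).1 hS.isTree
    refine (G.isTree_iff r S'.T).2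
      ⟨by rw [hT]; exact h1.exchange G hd.circulation hd.support hl0, ?_⟩
    rw [hT, Set.ncard_sdiff_singleton_of_mem hlTe, Set.union_singleton,
      Set.ncard_insert_of_notMem heT, Nat.add_sub_cancel, h2]
  · rw [hflow']
    exact G.isFlow_augment hS.isFlow hd.values hd.circulation hθ0
      fun a ha => hmin ⟨a, ha, rfl⟩
  · intro a ha
    rw [hL] at ha
    rw [hflow]
    rcases ha with ⟨ha, hae⟩ | ⟨rfl, ha⟩
    · rw [hS.flow_L a ha, hd0 a (fun h => hTL h ha) hae]; ring
    · have h1 : d a = -1 := by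
        rcases hd.values a with h | h | h
        · exact h
        · linarith
        · linarith
      rw [residual, if_neg (not_lt.2 ha.le)] at hlθ
      rw [h1, hlθ]; ring
  · intro a ha
    rw [hU] at ha
    rw [hflow]
    rcases ha with ⟨ha, hae⟩ | ⟨rfl, ha⟩
    · rw [hS.flow_U a ha, hd0 a (fun h => hTU h ha) hae]; ring
    · have h1 : d a = 1 := by
        rcases hd.values a with h | h | h
        · linarith
        · linarith
        · exact h
      rw [residual, if_pos ha] at hlθ
      rw [h1, ← hlθ]; ring

/-- Shows that an execution gets stuck only at a final structure. -/
theorem exists_pivot [Fintype V] {c : E → ℝ} {r : V} {leave : Set E → E} {S : TreeStructure E}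
    (hS : G.IsSpanningTreeStructure S) (hf : ¬ G.IsFinal c r S) :
    ∃ S' θ, G.Pivot c r leave S S' θ := by
  classical
  obtain ⟨π, hπ⟩ := G.exists_treePotential hS.isTree c r
  have hv : (Finset.univ.filter (G.Violates c π S)).Nonempty := by
    by_contra h
    refine hf ⟨π, hπ, fun e he => h ⟨e, by simpa using he⟩⟩
  obtain ⟨e, he, hmax⟩ := Finset.exists_max_image _ (fun a => |G.reducedCost c π a|) hv
  simp only [Finset.mem_filter, Finset.mem_univ, true_and] at he hmax
  obtain ⟨d, hd⟩ := G.exists_isPivotCycle hS.isTree hS.disjoint_LU (he.notMem_T hS)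
  have hne : (Finset.univ.filter (fun a => d a ≠ 0)).Nonempty :=
    ⟨e, by simpa using hd.ne_zero he⟩
  obtain ⟨a₀, ha₀, hmin⟩ := Finset.exists_min_image _ (fun a => G.residual S.flow d a) hne
  simp only [Finset.mem_filter, Finset.mem_univ, true_and] at ha₀ hmin
  set θ := G.residual S.flow d a₀ with hθ
  set l := leave {a | d a ≠ 0 ∧ G.residual S.flow d a = θ} with hl
  refine ⟨⟨(S.T ∪ {e}) \ {l}, (S.L \ {e}) ∪ {a | a = l ∧ d a < 0},
    (S.U \ {e}) ∪ {a | a = l ∧ 0 < d a}, fun a => S.flow a + θ * d a⟩, θ, π, e, l, d, hπ, he, hmax,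
    hd, ⟨⟨a₀, ha₀, rfl⟩, ?_⟩, hl, fun a => rfl, rfl, rfl, rfl⟩
  rintro x ⟨a, ha, rfl⟩
  exact hmin a ha

end FlowNetwork

/-! ### The algorithm as parametric simplex method in the cost of `p` -/

namespace FlowNetwork

variable {V E : Type} (G : FlowNetwork V E)

open scoped Classical in
/-- The cost function `c` with the cost of `p` increased by `y`. -/
def shiftCost (c : E → ℝ) (p : E) (y : ℝ) (a : E) : ℝ := c a + if a = p then y else 0

variable [Fintype E]

theorem sum_mul_shiftCost (d c : E → ℝ) (p : E) (y : ℝ) :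
    ∑ a, d a * shiftCost c p y a = ∑ a, d a * c a + y * d p := by
  classical
  simp only [shiftCost, mul_add, Finset.sum_add_distrib]
  simp [mul_comm]

/-- `f` is a flow of minimum cost. -/
def IsMinCostFlow (c f : E → ℝ) : Prop :=
  G.IsFlow f ∧ ∀ g, G.IsFlow g → ∑ a, f a * c a ≤ ∑ a, g a * c a

/-- Complementary slackness implies optimality. -/
theorem isMinCostFlow_of_reducedCost [Fintype V] {c f : E → ℝ} (hf : G.IsFlow f) (π : V → ℝ)
    (h0 : ∀ e, 0 < G.reducedCost c π e → f e = 0)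
    (h1 : ∀ e, G.reducedCost c π e < 0 → f e = G.cap e) : G.IsMinCostFlow c f := by
  refine ⟨hf, fun g hg => ?_⟩
  have hd : ∀ v, G.inflow (fun a => g a + (-1) * f a) v = G.outflow (fun a => g a + (-1) * f a) v := by
    intro v
    rw [inflow_add_smul, outflow_add_smul, ← hg.2 v, ← hf.2 v]
    ring
  have hsum := G.sum_mul_reducedCost hd c π
  have hnn : 0 ≤ ∑ a, (g a + (-1) * f a) * G.reducedCost c π a := by
    refine Finset.sum_nonneg fun a _ => ?_
    rcases lt_trichotomy (G.reducedCost c π a) 0 with h | h | h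
    · rw [h1 a h]
      exact mul_nonneg_of_nonpos_of_nonpos (by linarith [(hg.1 a).2]) h.le
    · rw [h, mul_zero]
    · rw [h0 a h]
      exact mul_nonneg (by linarith [(hg.1 a).1]) h.le
  rw [hsum] at hnn
  have : ∑ a, (g a + (-1) * f a) * c a = ∑ a, g a * c a - ∑ a, f a * c a := by
    rw [← Finset.sum_sub_distrib]
    exact Finset.sum_congr rfl fun a _ => by ring
  linarith

variable {G} in
theorem IsFinal.isMinCostFlow [Fintype V] {c : E → ℝ} {r : V} {S : TreeStructure E}
    (hS : G.IsSpanningTreeStructure S) (h : G.IsFinal c r S) : G.IsMinCostFlow c S.flow := by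
  obtain ⟨π, hπ, hv⟩ := h
  have hcov : ∀ a, a ∈ S.T ∨ a ∈ S.L ∨ a ∈ S.U := fun a => by
    have : a ∈ S.T ∪ S.L ∪ S.U := hS.cover ▸ Set.mem_univ a
    rcases this with (h | h) | h <;> simp [h]
  refine G.isMinCostFlow_of_reducedCost hS.isFlow π (fun e he => ?_) (fun e he => ?_)
  · rcases hcov e with h | h | h
    · exact absurd (hπ.2 e h) he.ne'
    · exact hS.flow_L e h
    · exact absurd (Or.inr ⟨h, he⟩) (hv e)
  · rcases hcov e with h | h | h
    · exact absurd (hπ.2 e h) he.ne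
    · exact absurd (Or.inl ⟨h, he⟩) (hv e)
    · exact hS.flow_U e h

variable {G} in
/-- The flow on `p` in an optimal flow is antitone in the cost of `p`. -/
theorem IsMinCostFlow.le_of_lt {c f g : E → ℝ} {p : E} {y z : ℝ}
    (hf : G.IsMinCostFlow (shiftCost c p y) f) (hg : G.IsMinCostFlow (shiftCost c p z) g)
    (hyz : y < z) : g p ≤ f p := by
  have h1 := hf.2 g hg.1
  have h2 := hg.2 f hf.1
  simp only [sum_mul_shiftCost] at h1 h2
  by_contra! h
  nlinarith [mul_pos (sub_pos.2 hyz) (sub_pos.2 h)]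

/-- A pivot is a step of the parametric simplex method in the cost of the edge `p`. -/
theorem parametric_pivot [Fintype V] {c : E → ℝ} {r : V} {S S' : TreeStructure E} {p e l : E}
    {π : V → ℝ} {d : E → ℝ} {y : ℝ} (hy : y ≤ 0) (hS : G.IsSpanningTreeStructure S)
    (hfin : G.IsFinal (shiftCost c p y) r S)
    (hπ : G.IsTreePotential c r S.T π) (he : G.Violates c π S e)
    (hmax : ∀ a, G.Violates c π S a → |G.reducedCost c π a| ≤ |G.reducedCost c π e|)
    (hd : G.IsPivotCycle S e d) (hT : S'.T = (S.T ∪ {e}) \ {l})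
    (hL : S'.L = (S.L \ {e}) ∪ {a | a = l ∧ d a < 0})
    (hU : S'.U = (S.U \ {e}) ∪ {a | a = l ∧ 0 < d a}) (hl : d l ≠ 0) :
    y ≤ ∑ a, d a * c a ∧ ∑ a, d a * c a < 0 ∧
      G.IsFinal (shiftCost c p (∑ a, d a * c a)) r S ∧
      G.IsFinal (shiftCost c p (∑ a, d a * c a)) r S' := by
  set w := ∑ a, d a * c a with hw
  have hwe : w = -|G.reducedCost c π e| := G.cost_pivotCycle_of_violates hπ hd he
  have he0 : G.reducedCost c π e ≠ 0 := by
    rcases he with he | he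
    · exact he.2.ne
    · exact he.2.ne'
  have hw0 : w < 0 := by
    have := abs_pos.2 he0
    linarith
  obtain ⟨ρ, hρ, hρv⟩ := hfin
  have hcyc : ∀ a b, a ∉ S.T → G.IsPivotCycle S a b → 0 ≤ ∑ x, b x * c x + y * b p := by
    intro a b ha hb
    rw [← sum_mul_shiftCost]
    exact G.cost_pivotCycle_nonneg hS hρ hb ha (hρv a)
  -- The cycle has cost `w < 0` and shifted cost `w + y * d p ≥ 0`; as `y ≤ 0`, only `d p = -1` is
  -- possible.
  have hdp : d p = -1 ∧ y ≤ w := by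
    have := hcyc e d (he.notMem_T hS) hd
    rcases hd.values p with h | h | h <;> rw [h] at this
    · exact ⟨h, by linarith⟩
    · linarith
    · linarith
  have hfin' : G.IsFinal (shiftCost c p w) r S := by
    refine G.isFinal_of_cost_nonneg hS fun a b ha hb => ?_
    rw [sum_mul_shiftCost]
    have h1 := hcyc a b ha hb
    -- This is where the pivot rule enters: no cycle is cheaper than the chosen one. It settles the
    -- cycles with `b p = -1`; the others remain nonnegative because the shift only grows from `y`
    -- to `w`.
    have h2 : w ≤ ∑ x, b x * c x := by
      by_cases hv : G.Violates c π S a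
      · rw [G.cost_pivotCycle_of_violates hπ hb hv, hwe]
        exact neg_le_neg (hmax a hv)
      · exact hw0.le.trans (G.cost_pivotCycle_nonneg hS hπ hb ha hv)
    rcases hb.values p with h | h | h <;> rw [h] at h1 ⊢ <;> linarith [hdp.2]
  refine ⟨hdp.2, hw0, hfin', ?_⟩
  obtain ⟨σ, hσ, hσv⟩ := hfin'
  -- At shift `w` the pivot cycle costs exactly `0`, so the entering edge is tight and the same
  -- potentials `σ` serve both trees.
  have hσe : G.reducedCost (shiftCost c p w) σ e = 0 := by
    have h1 := G.cost_pivotCycle hσ hd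
    rw [sum_mul_shiftCost, ← hw, hdp.1] at h1
    have : d e * G.reducedCost (shiftCost c p w) σ e = 0 := by linarith
    exact (mul_eq_zero.1 this).resolve_left (hd.ne_zero he)
  have hσT : ∀ a ∈ S.T ∪ {e}, G.reducedCost (shiftCost c p w) σ a = 0 := by
    rintro a (ha | rfl)
    · exact hσ.2 a ha
    · exact hσe
  have hσl := hσT l (hd.support l hl)
  refine ⟨σ, ⟨hσ.1, fun a ha => hσT a (hT ▸ ha).1⟩, ?_⟩
  rintro a (⟨ha, hr⟩ | ⟨ha, hr⟩)
  · rw [hL] at ha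
    rcases ha with ha | ⟨rfl, -⟩
    · exact hσv a (Or.inl ⟨ha.1, hr⟩)
    · linarith
  · rw [hU] at ha
    rcases ha with ha | ⟨rfl, -⟩
    · exact hσv a (Or.inr ⟨ha.1, hr⟩)
    · linarith

/-- The cycle vectors of pivots, which take finitely many values. -/
def IsPivotVector (c : E → ℝ) (r : V) (S S' : TreeStructure E) (p : E) (d : E → ℝ) : Prop :=
  (∀ a, d a = -1 ∨ d a = 0 ∨ d a = 1) ∧
    G.IsFinal (shiftCost c p (∑ a, d a * c a)) r S ∧
    G.IsFinal (shiftCost c p (∑ a, d a * c a)) r S' ∧ ∑ a, d a * c a < 0 ∧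
    (∃ e π, G.IsTreePotential c r S.T π ∧ G.Violates c π S e ∧ G.IsPivotCycle S e d ∧
      ∃ l, d l ≠ 0 ∧ S'.T = (S.T ∪ {e}) \ {l} ∧
        S'.L = (S.L \ {e}) ∪ {a | a = l ∧ d a < 0} ∧ S'.U = (S.U \ {e}) ∪ {a | a = l ∧ 0 < d a})

variable {G} in
-- Applied to the cost of the preceding pivot cycle as `z`, the second clause makes the cycle costs
-- monotone along an execution.
theorem Pivot.exists_isPivotVector [Fintype V] {c : E → ℝ} {r : V} {leave : Set E → E}
    (hleave : ∀ A : Set E, A.Nonempty → leave A ∈ A) {S S' : TreeStructure E} {θ : ℝ} {p : E}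
    {y : ℝ} (hy : y ≤ 0) (hS : G.IsSpanningTreeStructure S)
    (hfin : G.IsFinal (shiftCost c p y) r S) (hp : G.Pivot c r leave S S' θ) :
    ∃ d, G.IsPivotVector c r S S' p d ∧
      ∀ z ≤ 0, G.IsFinal (shiftCost c p z) r S → z ≤ ∑ a, d a * c a := by
  obtain ⟨π, e, l, d, hπ, he, hmax, hd, ⟨⟨a₀, ha₀, hθ⟩, -⟩, hl, -, hT, hL, hU⟩ := hp
  have hl0 : d l ≠ 0 := by
    rw [hl]
    exact (hleave {a | d a ≠ 0 ∧ G.residual S.flow d a = θ} ⟨a₀, ha₀, hθ.symm⟩).1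
  obtain ⟨-, h2, h3, h4⟩ := G.parametric_pivot hy hS hfin hπ he hmax hd hT hL hU hl0
  exact ⟨d, ⟨hd.values, h3, h4, h2, e, π, hπ, he, hd, l, hl0, hT, hL, hU⟩, fun z hz hz' =>
    (G.parametric_pivot hz hS hz' hπ he hmax hd hT hL hU hl0).1⟩

/-- The costs satisfy no nontrivial integer relation. -/
def IntIndependent (c : E → ℝ) : Prop := ∀ d : E → ℤ, ∑ a, (d a : ℝ) * c a = 0 → d = 0

/-- The difference of two vectors with entries in `{-1, 0, 1}` is an integer relation. -/
theorem IntIndependent.eq_of_sum_eq {c : E → ℝ} (hc : IntIndependent c) {d d' : E → ℝ}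
    (hd : ∀ a, d a = -1 ∨ d a = 0 ∨ d a = 1) (hd' : ∀ a, d' a = -1 ∨ d' a = 0 ∨ d' a = 1)
    (h : ∑ a, d a * c a = ∑ a, d' a * c a) : d = d' := by
  have hz : ∀ a, ∃ k : ℤ, (k : ℝ) = d a - d' a := by
    intro a
    have h1 : ∃ k : ℤ, (k : ℝ) = d a := by
      rcases hd a with h | h | h
      · exact ⟨-1, by simp [h]⟩
      · exact ⟨0, by simp [h]⟩
      · exact ⟨1, by simp [h]⟩
    have h2 : ∃ k : ℤ, (k : ℝ) = d' a := by
      rcases hd' a with h | h | h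
      · exact ⟨-1, by simp [h]⟩
      · exact ⟨0, by simp [h]⟩
      · exact ⟨1, by simp [h]⟩
    obtain ⟨k, hk⟩ := h1
    obtain ⟨k', hk'⟩ := h2
    exact ⟨k - k', by push_cast; rw [hk, hk']⟩
  choose k hk using hz
  have h0 : k = 0 := by
    apply hc
    simp only [hk, sub_mul, Finset.sum_sub_distrib, h, sub_self]
  ext a
  have := hk a
  rw [h0] at this
  simp at this
  linarith

/-- Consecutive pivots have cycles of strictly increasing cost. -/
theorem pivotVector_cost_lt [Fintype V] {c : E → ℝ} (hc : IntIndependent c) {r : V}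
    {S S' S'' : TreeStructure E} {p : E} {d d' : E → ℝ}
    (hS' : G.IsSpanningTreeStructure S') (h : G.IsPivotVector c r S S' p d)
    (h' : G.IsPivotVector c r S' S'' p d') (hle : ∑ a, d a * c a ≤ ∑ a, d' a * c a) :
    ∑ a, d a * c a < ∑ a, d' a * c a := by
  refine lt_of_le_of_ne hle fun heq => ?_
  have hdd := hc.eq_of_sum_eq h.1 h'.1 heq
  subst hdd
  obtain ⟨-, -, -, -, e, π, hπ, he, hd, l, hl, hT, hL, hU⟩ := h
  obtain ⟨-, -, -, -, e', π', hπ', he', hd', -⟩ := h'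
  have heT := he'.notMem_T hS'
  -- If consecutive cycles coincide, the edge that enters has just left. Its sign in `d` when
  -- leaving is opposite to the one required on entering.
  have hel : e' = l := by
    by_contra hne
    exact heT (hT ▸ ⟨hd.support e' (hd'.ne_zero he'), hne⟩)
  subst hel
  rcases lt_or_gt_of_ne hl with h | h
  · have : e' ∈ S'.L := hL ▸ Or.inr ⟨rfl, h⟩
    linarith [hd'.entering_L this]
  · have : e' ∈ S'.U := hU ▸ Or.inr ⟨rfl, h⟩
    linarith [hd'.entering_U this]

/-- Cycle costs increase strictly, so the cycle vectors are pairwise different, but there are only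
finitely many vectors with entries in `{-1, 0, 1}`. -/
theorem not_exists_infinite_execution [Fintype V] {c : E → ℝ} (hc : IntIndependent c) {r : V}
    {leave : Set E → E} (hleave : ∀ A : Set E, A.Nonempty → leave A ∈ A) {S₀ : TreeStructure E}
    (hS₀ : G.IsSpanningTreeStructure S₀) {p : E} {y : ℝ} (hy : y ≤ 0)
    (hfin : G.IsFinal (shiftCost c p y) r S₀) :
    ¬ ∃ s : ℕ → TreeStructure E, s 0 = S₀ ∧ ∀ i, ∃ θ, G.Pivot c r leave (s i) (s (i + 1)) θ := by
  rintro ⟨s, rfl, hs⟩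
  choose θ hs using hs
  have hst : ∀ i, G.IsSpanningTreeStructure (s i) := by
    intro i
    induction i with
    | zero => exact hS₀
    | succ i ih => exact (hs i).isSpanningTreeStructure hleave ih
  have hex : ∀ i, ∃ z ≤ 0, G.IsFinal (shiftCost c p z) r (s i) := by
    intro i
    induction i with
    | zero => exact ⟨y, hy, hfin⟩
    | succ i ih =>
      obtain ⟨z, hz, hz'⟩ := ih
      obtain ⟨d, hd, -⟩ := (hs i).exists_isPivotVector hleave hz (hst i) hz'
      exact ⟨_, hd.2.2.2.1.le, hd.2.2.1⟩
  have hvec : ∀ i, ∃ d, G.IsPivotVector c r (s i) (s (i + 1)) p d ∧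
      ∀ z ≤ 0, G.IsFinal (shiftCost c p z) r (s i) → z ≤ ∑ a, d a * c a := by
    intro i
    obtain ⟨z, hz, hz'⟩ := hex i
    exact (hs i).exists_isPivotVector hleave hz (hst i) hz'
  choose d hd hle using hvec
  have hmono : StrictMono fun i => ∑ a, d i a * c a := by
    refine strictMono_nat_of_lt_succ fun i => ?_
    exact G.pivotVector_cost_lt hc (hst (i + 1)) (hd i) (hd (i + 1))
      (hle (i + 1) _ (hd i).2.2.2.1.le (hd i).2.2.1)
  have hinj : Function.Injective d := fun i j hij => hmono.injective (by simp only [hij])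
  refine Set.infinite_of_injective_forall_mem (s := {f : E → ℝ | ∀ a, f a ∈ ({-1, 0, 1} : Set ℝ)})
    hinj (fun i a => (hd i).1 a) (Set.Finite.pi' fun _ => by simp)

variable {G} in
theorem Execution.invariant [Fintype V] {c : E → ℝ} {r : V}
    {leave : Set E → E} (hleave : ∀ A : Set E, A.Nonempty → leave A ∈ A) {S₀ S : TreeStructure E}
    (hS₀ : G.IsSpanningTreeStructure S₀) {p : E} {y : ℝ} (hy : y ≤ 0)
    (hfin : G.IsFinal (shiftCost c p y) r S₀) {N : ℕ} (h : G.Execution c r leave S₀ N S) :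
    G.IsSpanningTreeStructure S ∧ ∃ z ≤ 0, G.IsFinal (shiftCost c p z) r S := by
  induction h with
  | start => exact ⟨hS₀, y, hy, hfin⟩
  | degenerate _ hp ih | nondegenerate _ _ hp ih =>
    obtain ⟨hS, z, hz, hz'⟩ := ih
    obtain ⟨d, hd, -⟩ := hp.exists_isPivotVector hleave hz hS hz'
    exact ⟨hp.isSpanningTreeStructure hleave hS, _, hd.2.2.2.1.le, hd.2.2.1⟩

/-- Between two optimal flows for the same cost of `p` there is at most one member of a family of
optimal flows for pairwise different costs of `p`. -/
theorem card_filter_lt_le {ι : Type*} [Fintype ι] {c g g' : E → ℝ} {p : E} {z : ℝ}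
    (hg : G.IsMinCostFlow (shiftCost c p z) g) (hg' : G.IsMinCostFlow (shiftCost c p z) g')
    {y : ι → ℝ} {f : ι → E → ℝ} (hf : ∀ i, G.IsMinCostFlow (shiftCost c p (y i)) (f i))
    (hy : Function.Injective y) (hv : Function.Injective fun i => f i p) :
    (Finset.univ.filter fun i => f i p < g p).card ≤
      (Finset.univ.filter fun i => f i p < g' p).card + 2 := by
  classical
  have hsub : (Finset.univ.filter fun i => f i p < g p) ⊆
      (Finset.univ.filter fun i => f i p < g' p) ∪ ((Finset.univ.filter fun i => f i p = g' p) ∪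
        (Finset.univ.filter fun i => y i = z)) := by
    intro i hi
    simp only [Finset.mem_union, Finset.mem_filter, Finset.mem_univ, true_and] at hi ⊢
    rcases lt_trichotomy (f i p) (g' p) with h | h | h
    · exact Or.inl h
    · exact Or.inr (Or.inl h)
    -- A member strictly between the two flows on `p` must belong to the shift `z` itself, by
    -- antitonicity on either side.
    · refine Or.inr (Or.inr (le_antisymm ?_ ?_))
      · by_contra! hlt
        exact absurd (hg'.le_of_lt (hf i) hlt) (not_le.2 h)
      · by_contra! hlt
        exact absurd ((hf i).le_of_lt hg hlt) (not_le.2 hi)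
  have h1 : (Finset.univ.filter fun i => f i p = g' p).card ≤ 1 :=
    Finset.card_le_one.2 fun i hi j hj => hv (by
      simp only [Finset.mem_filter, Finset.mem_univ, true_and] at hi hj
      simp only [hi, hj])
  have h2 : (Finset.univ.filter fun i => y i = z).card ≤ 1 :=
    Finset.card_le_one.2 fun i hi j hj => hy (by
      simp only [Finset.mem_filter, Finset.mem_univ, true_and] at hi hj
      rw [hi, hj])
  have h3 := Finset.card_le_card hsub
  have h4 := Finset.card_union_le (Finset.univ.filter fun i => f i p < g' p)
    ((Finset.univ.filter fun i => f i p = g' p) ∪ (Finset.univ.filter fun i => y i = z))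
  have h5 := Finset.card_union_le (Finset.univ.filter fun i => f i p = g' p)
    (Finset.univ.filter fun i => y i = z)
  omega

variable {G} in
-- Induction on the execution: a degenerate pivot keeps the flow, and a non-degenerate one joins two
-- flows that are optimal for the same shift, so it passes at most two members.
theorem Execution.card_filter_lt_le [Fintype V] {c : E → ℝ} {r : V}
    {leave : Set E → E} (hleave : ∀ A : Set E, A.Nonempty → leave A ∈ A) {S₀ S : TreeStructure E}
    (hS₀ : G.IsSpanningTreeStructure S₀) {p : E} {y₀ : ℝ} (hy₀ : y₀ ≤ 0)
    (hfin : G.IsFinal (shiftCost c p y₀) r S₀) {N : ℕ} (h : G.Execution c r leave S₀ N S)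
    {ι : Type*} [Fintype ι]
    {y : ι → ℝ} {f : ι → E → ℝ} (hf : ∀ i, G.IsMinCostFlow (shiftCost c p (y i)) (f i))
    (hy : Function.Injective y) (hv : Function.Injective fun i => f i p) :
    (Finset.univ.filter fun i => f i p < S₀.flow p).card ≤
      (Finset.univ.filter fun i => f i p < S.flow p).card + 2 * N := by
  induction h with
  | start => simp
  | degenerate _ hp ih =>
    obtain ⟨π, e, l, d, -, -, -, -, -, -, hflow, -⟩ := hp
    simpa [hflow] using ih
  | nondegenerate hex _ hp ih =>
    obtain ⟨hS, z, hz, hz'⟩ := hex.invariant hleave hS₀ hy₀ hfin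
    obtain ⟨d, hd, -⟩ := hp.exists_isPivotVector hleave hz hS hz'
    have := G.card_filter_lt_le (hd.2.1.isMinCostFlow hS)
      (hd.2.2.1.isMinCostFlow (hp.isSpanningTreeStructure hleave hS)) hf hy hv
    omega

/-- The number of nondegenerate iterations is at least half the number of different optimal flows
that occur when the cost of `p` grows. -/
theorem needsNondegenerate_of_family [Fintype V] (hb : ∀ v, G.budget v = 0) {c : E → ℝ}
    (hc : IntIndependent c) (hpos : ∀ e, 0 < c e) {r : V} {leave : Set E → E}
    (hleave : ∀ A : Set E, A.Nonempty → leave A ∈ A) {S₀ : TreeStructure E}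
    (hS₀ : G.IsSpanningTreeStructure S₀) {p : E} {y₀ : ℝ} (hy₀ : y₀ ≤ 0)
    (hfin : G.IsFinal (shiftCost c p y₀) r S₀) {ι : Type*} [Fintype ι]
    {y : ι → ℝ} {f : ι → E → ℝ} (hf : ∀ i, G.IsMinCostFlow (shiftCost c p (y i)) (f i))
    (hy : Function.Injective y) (hv : Function.Injective fun i => f i p)
    (hlt : ∀ i, f i p < S₀.flow p) :
    G.NeedsNondegenerate c r leave S₀ (Fintype.card ι / 2) := by
  classical
  refine ⟨G.not_exists_infinite_execution hc hleave hS₀ hy₀ hfin, fun N S hex hstuck => ?_⟩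
  obtain ⟨hS, -⟩ := hex.invariant hleave hS₀ hy₀ hfin
  have hSf : G.IsFinal c r S := by
    by_contra h
    exact hstuck (G.exists_pivot hS h)
  refine ⟨hSf, ?_⟩
  -- With zero budgets the empty flow is feasible, and with positive costs it is the only optimum.
  have hzero : S.flow p = 0 := by
    have h0 : G.IsFlow (0 : E → ℝ) :=
      ⟨fun e => ⟨le_rfl, G.cap_nonneg e⟩, fun v => by simp [hb, inflow, outflow]⟩
    have h1 := (hSf.isMinCostFlow hS).2 0 h0
    have h2 : ∀ a ∈ Finset.univ, 0 ≤ S.flow a * c a := fun a _ =>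
      mul_nonneg (hS.isFlow.1 a).1 (hpos a).le
    have h3 : ∑ a, S.flow a * c a = 0 :=
      le_antisymm (by simpa using h1) (Finset.sum_nonneg h2)
    have := (Finset.sum_eq_zero_iff_of_nonneg h2).1 h3 p (Finset.mem_univ p)
    exact (mul_eq_zero.1 this).resolve_right (hpos p).ne'
  have hcard := hex.card_filter_lt_le hleave hS₀ hy₀ hfin hf hy hv
  rw [Finset.filter_true_of_mem fun i _ => hlt i, Finset.filter_false_of_mem fun i _ => by
    rw [hzero]; exact not_lt.2 ((hf i).1.1 p).1, Finset.card_empty, zero_add,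
    Finset.card_univ] at hcard
  have : (Fintype.card ι : ℝ) ≤ 2 * N := by exact_mod_cast hcard
  linarith

end FlowNetwork

/-! ### Two-terminal networks and gadgets -/

open FlowNetwork

theorem FlowNetwork.IntIndependent.ne_zero {E : Type} [Fintype E] {c : E → ℝ}
    (hc : IntIndependent c) (e : E) : c e ≠ 0 := by
  classical
  intro h
  have := hc (Pi.single e 1) (by simp [Pi.single_apply, h])
  simpa using congrFun this e

theorem FlowNetwork.IntIndependent.comp_inl {E E' : Type} [Fintype E] [Fintype E']
    {c : E ⊕ E' → ℝ} (hc : IntIndependent c) : IntIndependent (c ∘ Sum.inl) := by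
  intro d hd
  have := hc (Sum.elim d 0) (by simpa [Fintype.sum_sum_type] using hd)
  ext e
  simpa using congrFun this (Sum.inl e)

/-- A network with source `s`, sink `t` and lower bounds `lo` for the edge costs. -/
structure TwoTerminalNet (V E : Type) where
  src : E → V
  tgt : E → V
  cap : E → ℝ
  lo : E → ℝ
  s : V
  t : V

namespace TwoTerminalNet

variable {V E : Type} (N : TwoTerminalNet V E)

/-- `f` sends `v` units from `s` to `t` and respects the capacities. -/
def IsFlowOfValue [Fintype E] (f : E → ℝ) (v : ℝ) : Prop :=
  (∀ e, 0 ≤ f e ∧ f e ≤ N.cap e) ∧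
    ∀ π : V → ℝ, ∑ e, f e * (π (N.src e) - π (N.tgt e)) = v * (π N.s - π N.t)

/-- At price `lam` it is optimal to send `v` units from `s` to `t`. -/
def HasOptimalFlow [Fintype E] (c : E → ℝ) (lam v : ℝ) : Prop :=
  ∃ (f : E → ℝ) (π : V → ℝ), N.IsFlowOfValue f v ∧ π N.s - π N.t = lam ∧
    ∀ e, (0 < c e - π (N.src e) + π (N.tgt e) → f e = 0) ∧
      (c e - π (N.src e) + π (N.tgt e) < 0 → f e = N.cap e)

/-- `T` is a spanning forest of two trees, one containing `s` and one containing `t`. -/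
structure IsForest [Fintype V] (T : Set E) (side : V → Prop) : Prop where
  side_s : side N.s
  side_t : ¬ side N.t
  side_iff : ∀ e ∈ T, side (N.src e) ↔ side (N.tgt e)
  spans : ∀ π : V → ℝ, (∀ e ∈ T, π (N.src e) = π (N.tgt e)) →
    ∀ v, (side v → π v = π N.s) ∧ (¬ side v → π v = π N.t)
  card : T.ncard + 2 = Fintype.card V

/-- A spanning structure for the maximum flow, of value `F`. -/
structure IsMaxStructure [Fintype V] [Fintype E] (F : ℝ) (T U : Set E) (side : V → Prop)
    (f : E → ℝ) : Prop where
  forest : N.IsForest T side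
  disjoint : Disjoint T U
  upper : ∀ e ∈ U, side (N.src e) ∧ ¬ side (N.tgt e) ∧ f e = N.cap e
  lower : ∀ e, e ∉ T → e ∉ U → ¬ side (N.src e) ∧ side (N.tgt e) ∧ f e = 0
  flow : N.IsFlowOfValue f F

/-- For all costs in `[lo, lo + ε]` there are `K` prices in `(0, b)` with different optimal
flow values in `(0, F)`. -/
structure IsGadget [Fintype V] [Fintype E] (ε b F : ℝ) (K : ℕ) : Prop where
  injective : Function.Injective fun e => s(N.src e, N.tgt e)
  no_loop : ∀ e, N.src e ≠ N.tgt e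
  terminals_ne : N.s ≠ N.t
  not_terminals : ∀ e, s(N.src e, N.tgt e) ≠ s(N.s, N.t)
  cap_nonneg : ∀ e, 0 ≤ N.cap e
  value_pos : 0 < F
  lo_nonneg : ∀ e, 0 ≤ N.lo e
  lo_le : ∀ e, N.lo e + ε ≤ 1
  zero_structure : ∃ T side, N.IsForest T side ∧
    ∀ e, e ∉ T → side (N.src e) ∧ ¬ side (N.tgt e)
  max_structure : ∃ T U side f, N.IsMaxStructure F T U side f
  family : ∀ c : E → ℝ, (∀ e, N.lo e ≤ c e ∧ c e ≤ N.lo e + ε) → IntIndependent c →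
    ∃ (ι : Type) (_ : Fintype ι) (lam v : ι → ℝ), Fintype.card ι = K ∧
      Function.Injective lam ∧ Function.Injective v ∧
      ∀ i, (0 < lam i ∧ lam i < b) ∧ (0 < v i ∧ v i < F) ∧ N.HasOptimalFlow c (lam i) (v i)

theorem IsGadget.mono [Fintype V] [Fintype E] {ε b b' F : ℝ} {K : ℕ} (h : N.IsGadget ε b F K)
    (hb : b ≤ b') : N.IsGadget ε b' F K :=
  { h with
    family := fun c hc hi => by
      obtain ⟨ι, hι, lam, v, h1, h2, h3, h4⟩ := h.family c hc hi
      exact ⟨ι, hι, lam, v, h1, h2, h3, fun i =>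
        ⟨⟨(h4 i).1.1, (h4 i).1.2.trans_le hb⟩, (h4 i).2⟩⟩ }

/-! ### The base gadget -/

/-- The source is joined to `n` nodes, `n` further nodes are joined to the sink, and the edge
`u e → w e` is present for every `e`. -/
def base (n m : ℕ) (u w : Fin m → Fin n) :
    TwoTerminalNet (Bool ⊕ Bool × Fin n) ((Bool × Fin n) ⊕ Fin m) where
  src := Sum.elim (fun x => if x.1 then Sum.inl true else Sum.inr x) fun e => Sum.inr (true, u e)
  tgt := Sum.elim (fun x => if x.1 then Sum.inr x else Sum.inl false) fun e => Sum.inr (false, w e)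
  cap := Sum.elim (fun _ => m) fun _ => 1
  lo := 0
  s := Sum.inl true
  t := Sum.inl false

section base

variable {n m : ℕ} {u w : Fin m → Fin n}

/-- The flow in the base gadget with values `x` on the middle edges. -/
def baseFlow (u w : Fin m → Fin n) (x : Fin m → ℝ) : (Bool × Fin n) ⊕ Fin m → ℝ :=
  Sum.elim (fun y => ∑ e, if (if y.1 then u e else w e) = y.2 then x e else 0) x

theorem isFlowOfValue_baseFlow {x : Fin m → ℝ} (hx : ∀ e, 0 ≤ x e ∧ x e ≤ 1) :
    (base n m u w).IsFlowOfValue (baseFlow u w x) (∑ e, x e) := by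
  refine ⟨?_, fun π => ?_⟩
  · rintro (y | e)
    · change 0 ≤ ∑ e : Fin m, _ ∧ ∑ e : Fin m, _ ≤ (m : ℝ)
      refine ⟨Finset.sum_nonneg fun e _ => ?_, ?_⟩
      · split_ifs <;> first | exact (hx e).1 | exact le_rfl
      · refine (Finset.sum_le_card_nsmul Finset.univ _ 1 fun e _ => ?_).trans (by simp)
        split_ifs <;> first | exact (hx e).2 | exact zero_le_one
    · exact hx e
  · simp only [Fintype.sum_sum_type, Fintype.sum_prod_type, Fintype.sum_bool, baseFlow, base,
      Sum.elim_inl, Sum.elim_inr, if_true, Finset.sum_mul, Bool.false_eq_true, if_false]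
    rw [Finset.sum_comm, add_assoc, Finset.sum_comm (s := Finset.univ) (t := Finset.univ)
      (f := fun i e => (if w e = i then x e else 0) * (π (Sum.inr (false, i)) - π (Sum.inl false))),
      ← Finset.sum_add_distrib, ← Finset.sum_add_distrib]
    refine Finset.sum_congr rfl fun e _ => ?_
    simp only [ite_mul, zero_mul, Finset.sum_ite_eq, Finset.mem_univ, if_true]
    ring

/-- The cost of the path through the middle edge `e`. -/
def basePathCost (u w : Fin m → Fin n) (c : (Bool × Fin n) ⊕ Fin m → ℝ) (e : Fin m) : ℝ :=
  c (Sum.inl (true, u e)) + c (Sum.inr e) + c (Sum.inl (false, w e))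

/-- The potentials make all edges at the terminals tight, so a middle edge sees the full difference
between its path cost and the price. -/
theorem base_hasOptimalFlow {x : Fin m → ℝ} (hx : ∀ e, 0 ≤ x e ∧ x e ≤ 1)
    {c : (Bool × Fin n) ⊕ Fin m → ℝ} {lam : ℝ} (h0 : ∀ e, lam < basePathCost u w c e → x e = 0)
    (h1 : ∀ e, basePathCost u w c e < lam → x e = 1) :
    (base n m u w).HasOptimalFlow c lam (∑ e, x e) := by
  refine ⟨baseFlow u w x, Sum.elim (fun b => if b then lam else 0)
    (fun y => if y.1 then lam - c (Sum.inl y) else c (Sum.inl y)), isFlowOfValue_baseFlow hx,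
    by simp [base], ?_⟩
  rintro (⟨b, i⟩ | e)
  · cases b <;> simp [base]
  · simp only [base, baseFlow, Sum.elim_inr, if_true, Bool.false_eq_true, if_false]
    refine ⟨fun h => h0 e ?_, fun h => h1 e ?_⟩ <;> unfold basePathCost <;> linarith

/-- Two paths through different middle edges would give an integer relation whose coefficient at the
middle edge `e` is `1`. -/
theorem basePathCost_injective {c : (Bool × Fin n) ⊕ Fin m → ℝ} (hc : IntIndependent c) :
    Function.Injective (basePathCost u w c) := by
  classical
  intro e e' h
  by_contra hne
  have := hc (Pi.single (Sum.inl (true, u e)) 1 + Pi.single (Sum.inr e) 1 +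
    Pi.single (Sum.inl (false, w e)) 1 - (Pi.single (Sum.inl (true, u e')) 1 +
    Pi.single (Sum.inr e') 1 + Pi.single (Sum.inl (false, w e')) 1)) ?_
  · have h := congrFun this (Sum.inr e)
    simp [hne] at h
  · unfold basePathCost at h
    simp only [Pi.sub_apply, Pi.add_apply, Int.cast_sub, Int.cast_add, sub_mul, add_mul,
      Finset.sum_sub_distrib, Finset.sum_add_distrib]
    simp only [Pi.single_apply, Int.cast_ite, Int.cast_one, Int.cast_zero, ite_mul, one_mul,
      zero_mul, Finset.sum_ite_eq', Finset.mem_univ, if_true]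
    linarith

/-- All middle edges with a path cheaper than that of `e₀` are saturated, `e₀` is half full. -/
def baseProfile (u w : Fin m → Fin n) (c : (Bool × Fin n) ⊕ Fin m → ℝ) (e₀ e : Fin m) : ℝ :=
  if basePathCost u w c e < basePathCost u w c e₀ then 1 else if e = e₀ then 1 / 2 else 0

theorem baseProfile_mem (c : (Bool × Fin n) ⊕ Fin m → ℝ) (e₀ e : Fin m) :
    0 ≤ baseProfile u w c e₀ e ∧ baseProfile u w c e₀ e ≤ 1 := by
  unfold baseProfile
  split_ifs <;> norm_num

theorem baseProfile_self (c : (Bool × Fin n) ⊕ Fin m → ℝ) (e : Fin m) :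
    baseProfile u w c e e = 1 / 2 := by
  simp [baseProfile]

theorem baseProfile_sum_lt {c : (Bool × Fin n) ⊕ Fin m → ℝ} {e₀ e₁ : Fin m}
    (h : basePathCost u w c e₀ < basePathCost u w c e₁) :
    ∑ e, baseProfile u w c e₀ e < ∑ e, baseProfile u w c e₁ e := by
  refine Finset.sum_lt_sum (fun e _ => ?_) ⟨e₀, Finset.mem_univ _, ?_⟩
  · by_cases h1 : basePathCost u w c e < basePathCost u w c e₀
    · simp [baseProfile, h1, h1.trans h]
    · by_cases h2 : e = e₀
      · subst h2
        rw [baseProfile_self]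
        simp only [baseProfile, h, if_true]
        norm_num
      · have : baseProfile u w c e₀ e = 0 := by simp [baseProfile, h1, h2]
        rw [this]
        exact (baseProfile_mem c e₁ e).1
  · rw [baseProfile_self]
    simp only [baseProfile, h, if_true]
    norm_num

theorem base_isForest : (base n m u w).IsForest (Set.range Sum.inl)
    (Sum.elim (fun b => b = true) fun y => y.1 = true) := by
  refine ⟨by simp [base], by simp [base], ?_, fun π hπ v => ?_, ?_⟩
  · rintro _ ⟨⟨b, i⟩, rfl⟩
    cases b <;> simp [base]
  · have h1 : ∀ i, π (Sum.inl true) = π (Sum.inr (true, i)) := fun i => by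
      simpa [base] using hπ (Sum.inl (true, i)) ⟨_, rfl⟩
    have h2 : ∀ i, π (Sum.inr (false, i)) = π (Sum.inl false) := fun i => by
      simpa [base] using hπ (Sum.inl (false, i)) ⟨_, rfl⟩
    rcases v with (_ | _) | ⟨_ | _, i⟩ <;> simp [base, ← h1, h2]
  · rw [← Set.image_univ, Set.ncard_image_of_injective _ Sum.inl_injective, Set.ncard_univ,
      Nat.card_eq_fintype_card]
    simp
    ring

/-- The critical prices are the `m` path costs, and at each of them half a unit on the critical edge
gives a value of its own. A path costs at most `3 * ε`; the bound `4 * ε` leaves strict room.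
Terminal edges have capacity `m` and never restrict the flow. -/
theorem base_isGadget (hm : 0 < m) (huw : Function.Injective fun e => (u e, w e)) {ε : ℝ}
    (hε : 0 < ε) (hε1 : ε ≤ 1) : (base n m u w).IsGadget ε (4 * ε) m m where
  injective := by
    rintro (⟨b, i⟩ | e) (⟨b', i'⟩ | e') h
    · cases b <;> cases b' <;> simp [base] at h <;> simp [h]
    · cases b <;> simp [base] at h
    · cases b' <;> simp [base] at h
    · have : u e = u e' ∧ w e = w e' := by simpa [base] using h
      rw [huw (Prod.ext this.1 this.2)]
  no_loop := by
    rintro (⟨b, i⟩ | e)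
    · cases b <;> simp [base]
    · simp [base]
  terminals_ne := by simp [base]
  not_terminals := by
    rintro (⟨b, i⟩ | e)
    · cases b <;> simp [base]
    · simp [base]
  cap_nonneg := by rintro (_ | _) <;> simp [base]
  value_pos := by exact_mod_cast hm
  lo_nonneg := by simp [base]
  lo_le e := by simpa [base] using hε1
  zero_structure := by
    refine ⟨_, _, base_isForest, ?_⟩
    rintro (x | e) h
    · exact absurd ⟨x, rfl⟩ h
    · simp [base]
  max_structure := by
    refine ⟨_, Set.range Sum.inr, _, baseFlow u w 1, base_isForest, ?_, ?_, ?_, ?_⟩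
    · rw [Set.disjoint_left]
      rintro _ ⟨x, rfl⟩ ⟨y, hy⟩
      cases hy
    · rintro _ ⟨e, rfl⟩
      simp [base, baseFlow]
    · rintro (x | e) h h'
      · exact absurd ⟨x, rfl⟩ h
      · exact absurd ⟨e, rfl⟩ h'
    · simpa using isFlowOfValue_baseFlow (n := n) (u := u) (w := w) (x := 1) (by simp)
  family := by
    intro c hc hi
    have hpos : ∀ e, 0 < c e := fun e => lt_of_le_of_ne (by simpa [base] using (hc e).1)
      (hi.ne_zero e).symm
    have hle : ∀ e, c e ≤ ε := fun e => by simpa [base] using (hc e).2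
    refine ⟨Fin m, inferInstance, basePathCost u w c, fun e₀ => ∑ e, baseProfile u w c e₀ e,
      Fintype.card_fin m, basePathCost_injective hi, fun e e' h => ?_, fun e₀ => ⟨⟨?_, ?_⟩, ⟨?_, ?_⟩,
        base_hasOptimalFlow (baseProfile_mem c e₀) (fun e he => ?_) (fun e he => ?_)⟩⟩
    · by_contra hne
      rcases lt_or_gt_of_ne ((basePathCost_injective hi).ne hne) with h' | h'
      · exact (baseProfile_sum_lt h').ne h
      · exact (baseProfile_sum_lt h').ne' h
    · exact add_pos (add_pos (hpos _) (hpos _)) (hpos _)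
    · unfold basePathCost
      linarith [hle (Sum.inl (true, u e₀)), hle (Sum.inr e₀), hle (Sum.inl (false, w e₀))]
    · exact Finset.sum_pos' (fun e _ => (baseProfile_mem c e₀ e).1)
        ⟨e₀, Finset.mem_univ _, by rw [baseProfile_self]; norm_num⟩
    · have : ∑ e, baseProfile u w c e₀ e < ∑ _e : Fin m, (1 : ℝ) :=
        Finset.sum_lt_sum (fun e _ => (baseProfile_mem c e₀ e).2)
          ⟨e₀, Finset.mem_univ _, by rw [baseProfile_self]; norm_num⟩
      simpa using this
    · have h2 : e ≠ e₀ := by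
        rintro rfl
        exact lt_irrefl _ he
      simp [baseProfile, he.not_gt, h2]
    · simp [baseProfile, he]

end base

end TwoTerminalNet

/-! ### Doubling a gadget: simplicity of the graph and optimal flows -/

namespace TwoTerminalNet

variable {V E : Type} (N : TwoTerminalNet V E)

/-- The `k`-th node of the path from the new source to `t` (`b = true`), respectively from `s` to
the new sink (`b = false`). The paths have `p` inner nodes. -/
def pathNode (p : ℕ) (b : Bool) : ℕ → V ⊕ (Bool ⊕ Bool × Fin p)
  | 0 => if b then Sum.inr (Sum.inl true) else Sum.inl N.s
  | k + 1 => if h : k < p then Sum.inr (Sum.inr (b, ⟨k, h⟩)) else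
      if b then Sum.inl N.t else Sum.inr (Sum.inl false)

/-- Add a new source and a new sink. The new source is joined to `s` by an edge and to `t` by a
path with `p + 1` edges, the new sink is reached from `t` by an edge and from `s` by a path with
`p + 1` edges. The lower bounds for the costs of both paths are `δ`. -/
def double (p : ℕ) (δ F : ℝ) :
    TwoTerminalNet (V ⊕ (Bool ⊕ Bool × Fin p)) (E ⊕ (Bool ⊕ Bool × Fin (p + 1))) where
  src := Sum.elim (fun e => Sum.inl (N.src e)) (Sum.elim
    (fun b => if b then Sum.inr (Sum.inl true) else Sum.inl N.t) fun x => N.pathNode p x.1 x.2)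
  tgt := Sum.elim (fun e => Sum.inl (N.tgt e)) (Sum.elim
    (fun b => if b then Sum.inl N.s else Sum.inr (Sum.inl false))
    fun x => N.pathNode p x.1 (x.2 + 1))
  cap := Sum.elim N.cap fun _ => F
  lo := Sum.elim N.lo (Sum.elim 0 fun _ => δ / (p + 1 : ℕ))
  s := Sum.inr (Sum.inl true)
  t := Sum.inr (Sum.inl false)

variable {p : ℕ} {δ F : ℝ}

theorem pathNode_succ_of_lt {k : ℕ} (b : Bool) (hk : k < p) :
    N.pathNode p b (k + 1) = Sum.inr (Sum.inr (b, ⟨k, hk⟩)) := by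
  simp [pathNode, hk]

theorem pathNode_last (b : Bool) :
    N.pathNode p b (p + 1) = if b then Sum.inl N.t else Sum.inr (Sum.inl false) := by
  simp [pathNode]

theorem pathNode_injective (hst : N.s ≠ N.t) {b b' : Bool} {k k' : ℕ} (hk : k ≤ p + 1)
    (hk' : k' ≤ p + 1) (h : N.pathNode p b k = N.pathNode p b' k') : b = b' ∧ k = k' := by
  rcases k with _ | k <;> rcases k' with _ | k' <;> cases b <;> cases b' <;>
    simp only [pathNode, if_true, Bool.false_eq_true, if_false] at h ⊢ <;> (try split_ifs at h) <;>
    simp_all <;> omega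

theorem pathNode_eq_inl {b : Bool} {k : ℕ} {v : V} (h : N.pathNode p b k = Sum.inl v) :
    (b = false ∧ k = 0 ∧ v = N.s) ∨ (b = true ∧ p < k ∧ v = N.t) := by
  rcases k with _ | k <;> cases b <;> simp only [pathNode] at h ⊢ <;> (try split_ifs at h) <;>
    simp_all

theorem double_endpoints_inl (e : E) :
    s((N.double p δ F).src (Sum.inl e), (N.double p δ F).tgt (Sum.inl e)) =
      s(Sum.inl (N.src e), Sum.inl (N.tgt e)) := rfl

/-- Writing the terminal edges as edges between the two paths reduces the comparison of endpoints to
`pathNode_injective`. -/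
theorem double_endpoints_terminal (b : Bool) :
    s((N.double p δ F).src (Sum.inr (Sum.inl b)), (N.double p δ F).tgt (Sum.inr (Sum.inl b))) =
      s(N.pathNode p true (if b then 0 else p + 1), N.pathNode p false (if b then 0 else p + 1)) := by
  cases b <;> simp [double, pathNode]

theorem double_endpoints_path (b : Bool) (i : Fin (p + 1)) :
    s((N.double p δ F).src (Sum.inr (Sum.inr (b, i))),
      (N.double p δ F).tgt (Sum.inr (Sum.inr (b, i)))) =
      s(N.pathNode p b i, N.pathNode p b (i + 1)) := rfl

theorem endpoints_inl_ne_terminal (u v : V) (b : Bool) :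
    s(Sum.inl u, Sum.inl v) ≠ s(N.pathNode p true (if b then 0 else p + 1),
      N.pathNode p false (if b then 0 else p + 1)) := by
  intro h
  cases b <;> simp [pathNode] at h

theorem endpoints_inl_ne_path (u v : V) (b : Bool) (i : Fin (p + 1)) :
    s(Sum.inl u, Sum.inl v) ≠ s(N.pathNode p b i, N.pathNode p b (i + 1)) := by
  intro h
  have hi := i.2
  rcases Sym2.eq_iff.1 h with ⟨h1, h2⟩ | ⟨h1, h2⟩ <;>
    rcases N.pathNode_eq_inl h1.symm with h3 | h3 <;>
    rcases N.pathNode_eq_inl h2.symm with h4 | h4 <;> first | omega | simp_all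

theorem endpoints_terminal_ne_path (hst : N.s ≠ N.t) (b b' : Bool) (i : Fin (p + 1)) :
    s(N.pathNode p true (if b then 0 else p + 1), N.pathNode p false (if b then 0 else p + 1)) ≠
      s(N.pathNode p b' i, N.pathNode p b' (i + 1)) := by
  have hi := i.2
  have hk : (if b then 0 else p + 1) ≤ p + 1 := by split_ifs <;> omega
  intro h
  rcases Sym2.eq_iff.1 h with ⟨h1, h2⟩ | ⟨h1, h2⟩
  · exact absurd ((N.pathNode_injective hst hk (by omega) h1).1.trans
      (N.pathNode_injective hst hk (by omega) h2).1.symm) (by simp)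
  · exact absurd ((N.pathNode_injective hst hk (by omega) h1).1.trans
      (N.pathNode_injective hst hk (by omega) h2).1.symm) (by simp)

theorem double_injective (hst : N.s ≠ N.t)
    (h : Function.Injective fun e => s(N.src e, N.tgt e)) :
    Function.Injective fun e => s((N.double p δ F).src e, (N.double p δ F).tgt e) := by
  rintro (e | b | ⟨b, i⟩) (e' | b' | ⟨b', i'⟩) heq <;>
    simp only [double_endpoints_inl, double_endpoints_terminal, double_endpoints_path] at heq
  · exact congrArg _ (h (Sym2.map.injective Sum.inl_injective heq))
  · exact absurd heq (N.endpoints_inl_ne_terminal _ _ _)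
  · exact absurd heq (N.endpoints_inl_ne_path _ _ _ _)
  · exact absurd heq.symm (N.endpoints_inl_ne_terminal _ _ _)
  · cases b <;> cases b' <;> simp_all [pathNode]
  · exact absurd heq (N.endpoints_terminal_ne_path hst _ _ _)
  · exact absurd heq.symm (N.endpoints_inl_ne_path _ _ _ _)
  · exact absurd heq.symm (N.endpoints_terminal_ne_path hst _ _ _)
  · have hi := i.2
    have hi' := i'.2
    rcases Sym2.eq_iff.1 heq with ⟨h1, h2⟩ | ⟨h1, h2⟩
    · obtain ⟨h3, h4⟩ := N.pathNode_injective hst (by omega) (by omega) h1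
      rw [h3, Fin.ext h4]
    · obtain ⟨-, h3⟩ := N.pathNode_injective hst (by omega) (by omega) h1
      obtain ⟨-, h4⟩ := N.pathNode_injective hst (by omega) (by omega) h2
      omega

theorem double_no_loop (hst : N.s ≠ N.t) (h : ∀ e, N.src e ≠ N.tgt e)
    (e : E ⊕ (Bool ⊕ Bool × Fin (p + 1))) : (N.double p δ F).src e ≠ (N.double p δ F).tgt e := by
  rcases e with e | b | ⟨b, i⟩
  · exact Sum.inl_injective.ne (h e)
  · cases b <;> simp [double]
  · intro heq
    have hi := i.2
    have heq' : N.pathNode p b i = N.pathNode p b (i + 1) := heq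
    have := (N.pathNode_injective hst (by omega) (by omega) heq').2
    omega

theorem double_not_terminals (hst : N.s ≠ N.t) (e : E ⊕ (Bool ⊕ Bool × Fin (p + 1))) :
    s((N.double p δ F).src e, (N.double p δ F).tgt e) ≠
      s((N.double p δ F).s, (N.double p δ F).t) := by
  have h1 : (N.double p δ F).s = N.pathNode p true 0 := rfl
  have h2 : (N.double p δ F).t = N.pathNode p false (p + 1) := by rw [pathNode_last]; rfl
  rcases e with e | b | ⟨b, i⟩
  · simp [double]
  · cases b <;> simp [double]
  · rw [h1, h2, double_endpoints_path]
    have hi := i.2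
    intro h
    rcases Sym2.eq_iff.1 h with ⟨h3, h4⟩ | ⟨h3, h4⟩
    · exact absurd ((N.pathNode_injective hst (by omega) (by omega) h3).1.symm.trans
        (N.pathNode_injective hst (by omega) (by omega) h4).1) (by simp)
    · exact absurd ((N.pathNode_injective hst (by omega) (by omega) h3).1.symm.trans
        (N.pathNode_injective hst (by omega) (by omega) h4).1) (by simp)

theorem sum_path (g : ℝ) (π : V ⊕ (Bool ⊕ Bool × Fin p) → ℝ) (b : Bool) :
    ∑ i : Fin (p + 1), g * (π (N.pathNode p b i) - π (N.pathNode p b (i + 1))) =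
      g * (π (N.pathNode p b 0) - π (N.pathNode p b (p + 1))) := by
  rw [← Finset.mul_sum, Finset.sum_range (fun i => π (N.pathNode p b i) - π (N.pathNode p b (i + 1)))
    |>.symm, Finset.sum_range_sub']

/-- The flow in the doubled network that is `f` on the old edges, `h` on the two new edges and `g`
on the two new paths. -/
def doubleFlow (p : ℕ) (f : E → ℝ) (h g : ℝ) : E ⊕ (Bool ⊕ Bool × Fin (p + 1)) → ℝ :=
  Sum.elim f (Sum.elim (fun _ => h) fun _ => g)

variable [Fintype E]

theorem isFlowOfValue_doubleFlow {f : E → ℝ} {v h g : ℝ} (hf : N.IsFlowOfValue f v)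
    (hh : 0 ≤ h ∧ h ≤ F) (hg : 0 ≤ g ∧ g ≤ F) (hvg : h = v + g) :
    (N.double p δ F).IsFlowOfValue (doubleFlow p f h g) (h + g) := by
  refine ⟨?_, fun π => ?_⟩
  · rintro (e | b | x)
    · exact hf.1 e
    · exact hh
    · exact hg
  · have h1 := hf.2 (fun v => π (Sum.inl v))
    simp only [Fintype.sum_sum_type, Fintype.sum_prod_type, Fintype.sum_bool, doubleFlow, double,
      Sum.elim_inl, Sum.elim_inr, if_true, Bool.false_eq_true, if_false]
    rw [h1, sum_path, sum_path, pathNode_last, pathNode_last]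
    simp only [pathNode, if_true, Bool.false_eq_true, if_false]
    -- Conservation at the old source and the old sink is exactly `h = v + g`.
    rw [hvg]
    ring

/-- The cost of the last edges of a path, from edge `k` on. -/
def tailCost (c : E ⊕ (Bool ⊕ Bool × Fin (p + 1)) → ℝ) (b : Bool) (k : ℕ) : ℝ :=
  ∑ i : Fin (p + 1), if k ≤ i then c (Sum.inr (Sum.inr (b, i))) else 0

omit [Fintype E] in
theorem tailCost_succ (c : E ⊕ (Bool ⊕ Bool × Fin (p + 1)) → ℝ) (b : Bool) (i : Fin (p + 1)) :
    tailCost c b i = c (Sum.inr (Sum.inr (b, i))) + tailCost c b (i + 1) := by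
  have : c (Sum.inr (Sum.inr (b, i))) =
      ∑ j : Fin (p + 1), if j = i then c (Sum.inr (Sum.inr (b, j))) else 0 := by simp
  rw [this, tailCost, tailCost, ← Finset.sum_add_distrib]
  refine Finset.sum_congr rfl fun j _ => ?_
  rcases lt_trichotomy j i with h | h | h
  · have h' : (j : ℕ) < i := h
    rw [if_neg (by omega), if_neg h.ne, if_neg (by omega), add_zero]
  · subst h
    simp
  · have h' : (i : ℕ) < j := h
    rw [if_pos (by omega), if_neg h.ne', if_pos (by omega), zero_add]

omit [Fintype E] in
theorem tailCost_last (c : E ⊕ (Bool ⊕ Bool × Fin (p + 1)) → ℝ) (b : Bool) :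
    tailCost c b (p + 1) = 0 := by
  refine Finset.sum_eq_zero fun i _ => if_neg ?_
  omega

/-- Node potentials of the doubled network: `a` and `z` are the potentials of the new source and
the new sink. -/
def doublePotential (c : E ⊕ (Bool ⊕ Bool × Fin (p + 1)) → ℝ) (π : V → ℝ) (a z : ℝ) :
    V ⊕ (Bool ⊕ Bool × Fin p) → ℝ :=
  Sum.elim π (Sum.elim (fun b => if b then a else z)
    fun x => (if x.1 then π N.t else z) + tailCost c x.1 (x.2 + 1))

omit [Fintype E] in
theorem doublePotential_pathNode (c : E ⊕ (Bool ⊕ Bool × Fin (p + 1)) → ℝ) (π : V → ℝ) (a z : ℝ)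
    (b : Bool) (i : Fin (p + 1)) :
    N.doublePotential c π a z (N.pathNode p b (i + 1)) =
      (if b then π N.t else z) + tailCost c b (i + 1) := by
  by_cases hi : (i : ℕ) < p
  · rw [pathNode_succ_of_lt N b hi]
    rfl
  · have : (i : ℕ) = p := by omega
    rw [this, pathNode_last, tailCost_last]
    cases b <;> simp [doublePotential]

/-- Here `x` and `z` are the potential drops along the two terminal edges, so the two paths bridge
drops `x + lam` and `lam + z`. Inner path nodes get potentials that make all but the first edge of a
path tight; the first edge then carries the reduced cost of the whole path, and only four slackness
conditions remain. -/
theorem double_hasOptimalFlow {c : E ⊕ (Bool ⊕ Bool × Fin (p + 1)) → ℝ} {lam v h g x z : ℝ}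
    (hf : N.HasOptimalFlow (c ∘ Sum.inl) lam v) (hh : 0 ≤ h ∧ h ≤ F) (hg : 0 ≤ g ∧ g ≤ F)
    (hvg : h = v + g)
    (hx : (0 < c (Sum.inr (Sum.inl true)) - x → h = 0) ∧
      (c (Sum.inr (Sum.inl true)) - x < 0 → h = F))
    (hz : (0 < c (Sum.inr (Sum.inl false)) - z → h = 0) ∧
      (c (Sum.inr (Sum.inl false)) - z < 0 → h = F))
    (hy : (0 < tailCost c true 0 - (x + lam) → g = 0) ∧
      (tailCost c true 0 - (x + lam) < 0 → g = F))
    (hy' : (0 < tailCost c false 0 - (lam + z) → g = 0) ∧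
      (tailCost c false 0 - (lam + z) < 0 → g = F)) :
    (N.double p δ F).HasOptimalFlow c (x + lam + z) (h + g) := by
  obtain ⟨f, π, hf, hlam, hopt⟩ := hf
  refine ⟨doubleFlow p f h g, N.doublePotential c π (π N.s + x) (π N.t - z),
    N.isFlowOfValue_doubleFlow hf hh hg hvg, ?_, ?_⟩
  · simp only [double, doublePotential, Sum.elim_inr, Sum.elim_inl, if_true, Bool.false_eq_true,
      if_false]
    linarith
  rintro (e | b | ⟨b, i⟩)
  · exact hopt e
  · cases b
    · have : c (Sum.inr (Sum.inl false)) - π N.t + (π N.t - z) = c (Sum.inr (Sum.inl false)) - z := by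
        ring
      simpa [double, doublePotential, doubleFlow, this] using hz
    · have : c (Sum.inr (Sum.inl true)) - (π N.s + x) + π N.s = c (Sum.inr (Sum.inl true)) - x := by
        ring
      simpa [double, doublePotential, doubleFlow, this] using hx
  · have htail := tailCost_succ c b i
    simp only [double, Sum.elim_inr, doublePotential_pathNode, doubleFlow]
    rcases Nat.eq_zero_or_pos i with hi | hi
    · rw [hi] at htail ⊢
      cases b
      · have : c (Sum.inr (Sum.inr (false, i))) - N.doublePotential c π (π N.s + x) (π N.t - z)
            (N.pathNode p false 0) + ((if false then π N.t else π N.t - z) + tailCost c false (0 + 1))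
            = tailCost c false 0 - (lam + z) := by
          simp only [pathNode, doublePotential, Bool.false_eq_true, if_false, Sum.elim_inl]
          linarith
        rw [← this] at hy'
        exact hy'
      · have : c (Sum.inr (Sum.inr (true, i))) - N.doublePotential c π (π N.s + x) (π N.t - z)
            (N.pathNode p true 0) + ((if true then π N.t else π N.t - z) + tailCost c true (0 + 1))
            = tailCost c true 0 - (x + lam) := by
          simp only [pathNode, doublePotential, if_true, Sum.elim_inl, Sum.elim_inr]
          linarith
        rw [← this] at hy
        exact hy
    · obtain ⟨j, hj⟩ : ∃ j : Fin (p + 1), (j : ℕ) + 1 = i := ⟨⟨i - 1, by omega⟩, by simp; omega⟩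
      have h1 := N.doublePotential_pathNode c π (π N.s + x) (π N.t - z) b j
      rw [hj] at h1
      rw [h1]
      constructor <;> intro h <;> linarith

end TwoTerminalNet

/-! ### Doubling a gadget: extreme flows, and twice as many values -/

theorem Set.ncard_setOf_sumElim {α β : Type*} [Finite α] [Finite β] (P : α → Prop) (Q : β → Prop) :
    {x : α ⊕ β | Sum.elim P Q x}.ncard = {a | P a}.ncard + {b | Q b}.ncard := by
  have : {x : α ⊕ β | Sum.elim P Q x} = Sum.inl '' {a | P a} ∪ Sum.inr '' {b | Q b} := by
    ext (a | b) <;> simp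
  rw [this, Set.ncard_union_eq, Set.ncard_image_of_injective _ Sum.inl_injective,
    Set.ncard_image_of_injective _ Sum.inr_injective]
  rw [Set.disjoint_left]
  rintro _ ⟨a, -, rfl⟩ ⟨b, -, hb⟩
  cases hb

namespace TwoTerminalNet

variable {V E : Type} (N : TwoTerminalNet V E) {p : ℕ} {δ F : ℝ}

theorem eq_of_forall_eq_succ {g : ℕ → ℝ} {n : ℕ} (h : ∀ k < n, g k = g (k + 1)) :
    ∀ k ≤ n, g k = g n := by
  intro k hk
  have : ∀ j ≤ n, g j = g 0 := by
    intro j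
    induction j with
    | zero => simp
    | succ j ih => exact fun hj => (h j hj).symm.trans (ih (by omega))
  rw [this k hk, this n le_rfl]

/-- The forest of the empty flow in the doubled network. -/
def zeroForest (p : ℕ) (T : Set E) : Set (E ⊕ (Bool ⊕ Bool × Fin (p + 1))) :=
  {e | Sum.elim (· ∈ T) (Sum.elim (fun _ => True) fun x => x.2 ≠ 0) e}

/-- The side of the source for `zeroForest`. -/
def zeroSide (p : ℕ) (side : V → Prop) : V ⊕ (Bool ⊕ Bool × Fin p) → Prop :=
  Sum.elim side (Sum.elim (· = true) fun _ => False)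

/-- The forest of the maximum flow in the doubled network. -/
def maxForest (p : ℕ) (T : Set E) : Set (E ⊕ (Bool ⊕ Bool × Fin (p + 1))) :=
  {e | Sum.elim (· ∈ T) (Sum.elim (fun _ => False) fun _ => True) e}

/-- The side of the source for `maxForest`. -/
def maxSide (p : ℕ) (side : V → Prop) : V ⊕ (Bool ⊕ Bool × Fin p) → Prop :=
  Sum.elim (fun v => ¬ side v) (Sum.elim (· = true) fun x => x.1 = true)

variable {T : Set E} {side : V → Prop}

theorem zeroSide_pathNode (h : side N.s ∧ ¬ side N.t) (b : Bool) (k : ℕ) :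
    zeroSide p side (N.pathNode p b k) ↔ k = 0 := by
  rcases k with _ | k <;> cases b <;> simp only [pathNode] <;> (try split_ifs) <;>
    simp_all [zeroSide]

theorem maxSide_pathNode (h : side N.s ∧ ¬ side N.t) (b : Bool) (k : ℕ) :
    maxSide p side (N.pathNode p b k) ↔ b = true := by
  rcases k with _ | k <;> cases b <;> simp only [pathNode] <;> (try split_ifs) <;>
    simp_all [maxSide]

variable [Fintype V]

theorem isForest_zeroForest [Finite E] (h : N.IsForest T side) :
    (N.double p δ F).IsForest (zeroForest p T) (zeroSide p side) := by
  refine ⟨rfl, by simp [double, zeroSide], ?_, fun π hπ => ?_, ?_⟩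
  · rintro (e | b | ⟨b, i⟩) he
    · exact h.side_iff e he
    · cases b <;> simp [double, zeroSide, h.side_s, h.side_t]
    · have hi : (i : ℕ) ≠ 0 := fun hi => he (Fin.ext hi)
      change zeroSide p side (N.pathNode p b i) ↔ zeroSide p side (N.pathNode p b (i + 1))
      rw [N.zeroSide_pathNode ⟨h.side_s, h.side_t⟩, N.zeroSide_pathNode ⟨h.side_s, h.side_t⟩]
      omega
  · have hold := h.spans (fun v => π (Sum.inl v)) (fun e he => hπ (Sum.inl e) he)
    have hs : π (Sum.inr (Sum.inl true)) = π (Sum.inl N.s) := by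
      simpa [double] using hπ (Sum.inr (Sum.inl true)) trivial
    have ht : π (Sum.inl N.t) = π (Sum.inr (Sum.inl false)) := by
      simpa [double] using hπ (Sum.inr (Sum.inl false)) trivial
    have hpath : ∀ b, ∀ k ≤ p, π (N.pathNode p b (k + 1)) = π (N.pathNode p b (p + 1)) := by
      intro b
      refine eq_of_forall_eq_succ (g := fun k => π (N.pathNode p b (k + 1))) fun k hk => ?_
      exact hπ (Sum.inr (Sum.inr (b, ⟨k + 1, by omega⟩))) (by simp [zeroForest])
    rintro (v | b | ⟨b, i⟩)
    · have := hold v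
      simp only [zeroSide, double, Sum.elim_inl, ht, hs] at this ⊢
      exact this
    · cases b <;> simp [zeroSide, double]
    · have h1 := hpath b i i.2.le
      rw [pathNode_succ_of_lt N b i.2, pathNode_last] at h1
      cases b <;> simp_all [zeroSide, double]
  · rw [zeroForest, Set.ncard_setOf_sumElim, Set.ncard_setOf_sumElim]
    have h1 : {x : Bool × Fin (p + 1) | x.2 ≠ 0} =
        (fun x : Bool × Fin p => (x.1, x.2.succ)) '' Set.univ := by
      ext ⟨b, i⟩
      simp only [ne_eq, Set.mem_ofPred_eq, Set.image_univ, Set.mem_range, Prod.mk.injEq,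
        Prod.exists, ← Fin.exists_succ_eq]
      exact ⟨fun ⟨j, hj⟩ => ⟨b, j, rfl, hj⟩, fun ⟨_, j, _, hj⟩ => ⟨j, hj⟩⟩
    have h2 : Function.Injective fun x : Bool × Fin p => (x.1, x.2.succ) := by
      rintro ⟨b, i⟩ ⟨b', i'⟩ h
      simpa using h
    rw [h1, Set.ncard_image_of_injective _ h2]
    have := h.card
    simp only [Set.ofPred_mem_eq, Set.ofPred_true, Set.ncard_univ, Nat.card_eq_fintype_card,
      Fintype.card_sum, Fintype.card_prod, Fintype.card_bool, Fintype.card_fin]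
    omega

theorem isForest_maxForest [Finite E] (h : N.IsForest T side) :
    (N.double p δ F).IsForest (maxForest p T) (maxSide p side) := by
  refine ⟨rfl, by simp [double, maxSide], ?_, fun π hπ => ?_, ?_⟩
  · rintro (e | b | ⟨b, i⟩) he
    · exact not_congr (h.side_iff e he)
    · exact he.elim
    · change maxSide p side (N.pathNode p b i) ↔ maxSide p side (N.pathNode p b (i + 1))
      rw [N.maxSide_pathNode ⟨h.side_s, h.side_t⟩, N.maxSide_pathNode ⟨h.side_s, h.side_t⟩]
  · have hold := h.spans (fun v => π (Sum.inl v)) (fun e he => hπ (Sum.inl e) he)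
    have hpath : ∀ b, ∀ k ≤ p + 1, π (N.pathNode p b k) = π (N.pathNode p b (p + 1)) := by
      intro b
      refine eq_of_forall_eq_succ (g := fun k => π (N.pathNode p b k)) fun k hk => ?_
      exact hπ (Sum.inr (Sum.inr (b, ⟨k, by omega⟩))) trivial
    have hs := hpath false 0 (by omega)
    have ht := hpath true 0 (by omega)
    rw [pathNode_last] at hs ht
    simp only [pathNode, if_true, Bool.false_eq_true, if_false] at hs ht
    rintro (v | b | ⟨b, i⟩)
    · have := hold v
      simp only [maxSide, double, Sum.elim_inl, ht, ← hs, not_not] at this ⊢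
      exact ⟨this.2, this.1⟩
    · cases b <;> simp [maxSide, double]
    · have h1 := hpath b (i + 1) (by omega)
      rw [pathNode_succ_of_lt N b i.2, pathNode_last] at h1
      cases b <;> simp_all [maxSide, double]
  · rw [maxForest, Set.ncard_setOf_sumElim, Set.ncard_setOf_sumElim]
    have := h.card
    simp only [Set.ofPred_mem_eq, Set.ofPred_true, Set.ofPred_false, Set.ncard_empty,
      Set.ncard_univ, Nat.card_eq_fintype_card,
      Fintype.card_sum, Fintype.card_prod, Fintype.card_bool, Fintype.card_fin]
    omega

variable [Fintype E]

/-- At value `2 * F` both paths and both terminal edges carry `F`, and the old network is empty. So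
the old forest of the empty flow is used, with its sides swapped: the paths attach the old sink to
the new source and the old source to the new sink. -/
theorem isMaxStructure_double (h : N.IsForest T side) (hcap : ∀ e, 0 ≤ N.cap e) (hF : 0 ≤ F)
    (hT : ∀ e, e ∉ T → side (N.src e) ∧ ¬ side (N.tgt e)) :
    (N.double p δ F).IsMaxStructure (2 * F) (maxForest p T)
      {e | Sum.elim (fun _ => False) (Sum.elim (fun _ => True) fun _ => False) e}
      (maxSide p side) (doubleFlow p 0 F F) where
  forest := N.isForest_maxForest h
  disjoint := by
    rw [Set.disjoint_left]
    rintro (e | b | x) h1 h2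
    · exact h2
    · exact h1
    · exact h2
  upper := by
    rintro (e | b | x) he
    · exact he.elim
    · cases b <;> simp [double, maxSide, h.side_s, h.side_t, doubleFlow]
    · exact he.elim
  lower := by
    rintro (e | b | x) he he'
    · have := hT e he
      simpa [double, maxSide, doubleFlow] using this
    · exact absurd trivial he'
    · exact absurd trivial he
  flow := by
    rw [two_mul]
    refine N.isFlowOfValue_doubleFlow (v := 0) ⟨fun e => ⟨le_rfl, hcap e⟩, by simp⟩ ⟨hF, le_rfl⟩
      ⟨hF, le_rfl⟩ (by ring)

omit [Fintype V] [Fintype E] in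
theorem tailCost_zero_mem {c : E ⊕ (Bool ⊕ Bool × Fin (p + 1)) → ℝ} {ε : ℝ}
    (hc : ∀ e, (N.double p δ F).lo e ≤ c e ∧ c e ≤ (N.double p δ F).lo e + ε) (b : Bool) :
    δ ≤ tailCost c b 0 ∧ tailCost c b 0 ≤ δ + (p + 1 : ℕ) * ε := by
  have hsum : ∑ _i : Fin (p + 1), δ / (p + 1 : ℕ) = δ := by
    rw [Finset.sum_const, Finset.card_univ, Fintype.card_fin, nsmul_eq_mul]
    have : ((p + 1 : ℕ) : ℝ) ≠ 0 := by positivity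
    field_simp
  have hsum' : ∑ _i : Fin (p + 1), ε = (p + 1 : ℕ) * ε := by
    rw [Finset.sum_const, Finset.card_univ, Fintype.card_fin, nsmul_eq_mul]
  simp only [tailCost, Nat.zero_le, if_true]
  constructor
  · calc δ = ∑ _i : Fin (p + 1), δ / (p + 1 : ℕ) := hsum.symm
      _ ≤ _ := Finset.sum_le_sum fun i _ => (hc (Sum.inr (Sum.inr (b, i)))).1
  · calc _ ≤ ∑ _i : Fin (p + 1), (δ / (p + 1 : ℕ) + ε) :=
          Finset.sum_le_sum fun i _ => (hc (Sum.inr (Sum.inr (b, i)))).2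
      _ = _ := by rw [Finset.sum_add_distrib, hsum, hsum']

/-- A price `lam` of the old network yields two prices. At `x + lam + z` the paths are too
expensive, since `δ ≥ b + ε`, and the value stays `v`. At `y + w - lam` the terminal edges are
saturated and the paths are tight; they carry `F - v` each, the old network still carries `v`, and
the value is `2 * F - v`. The two ranges are separated by `F`. -/
theorem IsGadget.double {ε b : ℝ} {K : ℕ} (h : N.IsGadget ε b F K) (hε : 0 < ε) (hb : 0 ≤ b)
    (hδ : b + ε ≤ δ) (hlo : δ / (p + 1 : ℕ) + ε ≤ 1) :
    (N.double p δ F).IsGadget ε (2 * (δ + (p + 1 : ℕ) * ε)) (2 * F) (2 * K) where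
  injective := N.double_injective h.terminals_ne h.injective
  no_loop := N.double_no_loop h.terminals_ne h.no_loop
  terminals_ne := by simp [TwoTerminalNet.double]
  not_terminals := N.double_not_terminals h.terminals_ne
  cap_nonneg := by
    rintro (e | x)
    · exact h.cap_nonneg e
    · exact h.value_pos.le
  value_pos := by linarith [h.value_pos]
  lo_nonneg := by
    have : 0 ≤ δ := by linarith
    rintro (e | b | x)
    · exact h.lo_nonneg e
    · exact le_rfl
    · exact div_nonneg this (Nat.cast_nonneg _)
  lo_le := by
    have : 0 ≤ δ / (p + 1 : ℕ) := div_nonneg (by linarith) (Nat.cast_nonneg _)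
    rintro (e | b | x)
    · exact h.lo_le e
    · change 0 + ε ≤ 1
      linarith
    · exact hlo
  zero_structure := by
    obtain ⟨T, side, hT, hT'⟩ := h.zero_structure
    refine ⟨_, _, N.isForest_zeroForest hT, ?_⟩
    rintro (e | b | ⟨b, i⟩) he
    · exact hT' e he
    · exact absurd trivial he
    · have hi : i = 0 := by
        by_contra hi
        exact he hi
      subst hi
      change zeroSide p side (N.pathNode p b 0) ∧ ¬ zeroSide p side (N.pathNode p b 1)
      rw [N.zeroSide_pathNode ⟨hT.side_s, hT.side_t⟩, N.zeroSide_pathNode ⟨hT.side_s, hT.side_t⟩]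
      simp
  max_structure := by
    obtain ⟨T, side, hT, hT'⟩ := h.zero_structure
    exact ⟨_, _, _, _, N.isMaxStructure_double hT h.cap_nonneg h.value_pos.le hT'⟩
  family := by
    intro c hc hi
    obtain ⟨ι, hι, lam, v, hK, hlam, hv, hopt⟩ := h.family (c ∘ Sum.inl)
      (fun e => hc (Sum.inl e)) hi.comp_inl
    obtain ⟨hx0, hx1⟩ : 0 ≤ c (Sum.inr (Sum.inl true)) ∧ c (Sum.inr (Sum.inl true)) ≤ ε := by
      simpa [TwoTerminalNet.double] using hc (Sum.inr (Sum.inl true))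
    obtain ⟨hz0, hz1⟩ : 0 ≤ c (Sum.inr (Sum.inl false)) ∧ c (Sum.inr (Sum.inl false)) ≤ ε := by
      simpa [TwoTerminalNet.double] using hc (Sum.inr (Sum.inl false))
    obtain ⟨hy0, hy1⟩ := N.tailCost_zero_mem hc true
    obtain ⟨hw0, hw1⟩ := N.tailCost_zero_mem hc false
    set x := c (Sum.inr (Sum.inl true))
    set z := c (Sum.inr (Sum.inl false))
    set y := tailCost c true 0
    set w := tailCost c false 0
    have hF := h.value_pos
    refine ⟨ι ⊕ ι, inferInstance, Sum.elim (fun i => x + lam i + z) (fun i => y + w - lam i),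
      Sum.elim v (fun i => 2 * F - v i), by rw [Fintype.card_sum, hK, two_mul], ?_, ?_, ?_⟩
    · refine Function.Injective.sumElim (fun i j hij => hlam (by simpa using hij))
        (fun i j hij => hlam (by simpa using hij)) fun i j hij => ?_
      have h1 := (hopt i).1
      have h2 := (hopt j).1
      linarith
    · refine Function.Injective.sumElim hv (fun i j hij => hv (by simpa using hij)) fun i j hij => ?_
      have h1 := (hopt i).2.1
      have h2 := (hopt j).2.1
      linarith
    · rintro (i | i)
      · obtain ⟨⟨h1, h2⟩, ⟨h3, h4⟩, h5⟩ := hopt i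
        simp only [Sum.elim_inl]
        refine ⟨⟨by linarith, ?_⟩, ⟨h3, by linarith⟩, ?_⟩
        · have : 0 ≤ (p + 1 : ℕ) * ε := by positivity
          linarith
        · rw [← add_zero (v i)]
          refine N.double_hasOptimalFlow h5 ⟨h3.le, h4.le⟩ ⟨le_rfl, hF.le⟩ (by ring)
            ⟨fun hh => absurd hh (by simp [x]), fun hh => absurd hh (by simp [x])⟩
            ⟨fun hh => absurd hh (by simp [z]), fun hh => absurd hh (by simp [z])⟩
            ⟨fun _ => rfl, fun hh => ?_⟩ ⟨fun _ => rfl, fun hh => ?_⟩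
          · change y - (x + lam i) < 0 at hh
            linarith
          · change w - (lam i + z) < 0 at hh
            linarith
      · obtain ⟨⟨h1, h2⟩, ⟨h3, h4⟩, h5⟩ := hopt i
        simp only [Sum.elim_inr]
        refine ⟨⟨by linarith, by linarith⟩, ⟨by linarith, by linarith⟩, ?_⟩
        -- The drops along the terminal edges are `y - lam i` and `w - lam i`, which makes both
        -- paths tight.
        have e1 : y + w - lam i = (y - lam i) + lam i + (w - lam i) := by ring
        have e2 : 2 * F - v i = F + (F - v i) := by ring
        rw [e1, e2]
        refine N.double_hasOptimalFlow h5 ⟨hF.le, le_rfl⟩ ⟨by linarith, by linarith⟩ (by ring)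
          ⟨fun hh => ?_, fun _ => rfl⟩ ⟨fun hh => ?_, fun _ => rfl⟩
          ⟨fun hh => ?_, fun hh => ?_⟩ ⟨fun hh => ?_, fun hh => ?_⟩
        · change 0 < x - (y - lam i) at hh
          linarith
        · change 0 < z - (w - lam i) at hh
          linarith
        · change 0 < y - (y - lam i + lam i) at hh
          linarith
        · change y - (y - lam i + lam i) < 0 at hh
          linarith
        · change 0 < w - (lam i + (w - lam i)) at hh
          linarith
        · change w - (lam i + (w - lam i)) < 0 at hh
          linarith

end TwoTerminalNet

/-! ### Closing a gadget by a return edge from sink to source -/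

namespace TwoTerminalNet

variable {V E : Type} (N : TwoTerminalNet V E)

theorem connected_of_isForest [Fintype V] {T : Set E} {side : V → Prop} (h : N.IsForest T side)
    {π : V → ℝ} (hπ : ∀ e ∈ T, π (N.src e) = π (N.tgt e)) (hst : π N.t = π N.s) (u v : V) :
    π u = π v := by
  have key : ∀ v, π v = π N.s := fun v => by
    by_cases hv : side v
    · exact (h.spans π hπ v).1 hv
    · exact ((h.spans π hπ v).2 hv).trans hst
  rw [key u, key v]

variable [Fintype V] [Fintype E] {ε b F : ℝ} {K : ℕ}

/-- The flow network without supply and demand that arises from a gadget by adding an edge of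
capacity `F` from the sink to the source. -/
def close (h : N.IsGadget ε b F K) : FlowNetwork V (Option E) where
  src o := o.elim N.t N.src
  tgt o := o.elim N.s N.tgt
  cap o := o.elim F N.cap
  budget _ := 0
  no_loop := by
    rintro (_ | e)
    · exact h.terminals_ne.symm
    · exact h.no_loop e
  no_parallel := by
    rintro (_ | e) (_ | e') h1 h2
    · rfl
    · exact absurd (Sym2.eq_iff.2 (Or.inr ⟨h1.symm, h2.symm⟩)) (h.not_terminals e')
    · exact absurd (Sym2.eq_iff.2 (Or.inr ⟨h1, h2⟩)) (h.not_terminals e)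
    · exact congrArg some (h.injective (Sym2.eq_iff.2 (Or.inl ⟨h1, h2⟩)))
  no_reverse := by
    rintro (_ | e) (_ | e') ⟨h1, h2⟩
    · exact h.terminals_ne h2
    · exact h.not_terminals e' (Sym2.eq_iff.2 (Or.inl ⟨h2.symm, h1.symm⟩))
    · exact h.not_terminals e (Sym2.eq_iff.2 (Or.inl ⟨h1, h2⟩))
    · have := h.injective (Sym2.eq_iff.2 (Or.inr ⟨h1, h2⟩))
      subst this
      exact h.no_loop e h1
  cap_nonneg := by
    rintro (_ | e)
    · exact h.value_pos.le
    · exact h.cap_nonneg e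
  connected := by
    obtain ⟨T, side, hT, -⟩ := h.zero_structure
    have : Nonempty V := ⟨N.s⟩
    have := (SimpleGraph.connected_fromRel_iff (E := Option E) (src := fun o => o.elim N.t N.src)
      (tgt := fun o => o.elim N.s N.tgt) (by
        rintro (_ | e)
        · exact h.terminals_ne.symm
        · exact h.no_loop e) Set.univ).2 fun π hπ =>
        N.connected_of_isForest hT (fun e _ => hπ (some e) trivial) (hπ none trivial)
    simpa using this

variable {N}

theorem isFlow_close (h : N.IsGadget ε b F K) {f : E → ℝ} {v : ℝ} (hf : N.IsFlowOfValue f v)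
    (hv : 0 ≤ v ∧ v ≤ F) : (N.close h).IsFlow fun o => o.elim v f := by
  have hcirc : ∀ x, (N.close h).inflow (fun o => o.elim v f) x =
      (N.close h).outflow (fun o => o.elim v f) x := by
    rw [circulation_iff]
    intro π
    rw [Fintype.sum_option]
    have := hf.2 π
    simp only [close, Option.elim_none, Option.elim_some, this]
    ring
  refine ⟨?_, fun x => by rw [hcirc x]; exact zero_add _⟩
  rintro (_ | e)
  · exact hv
  · exact hf.1 e

/-- The shift gives the return edge cost `-lam`, so it is tight for the potentials of the gadget. -/
theorem isMinCostFlow_close (h : N.IsGadget ε b F K) {c : Option E → ℝ} {lam v : ℝ}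
    (hv : 0 < v ∧ v < F) (hopt : N.HasOptimalFlow (fun e => c (some e)) lam v) :
    ∃ f, (N.close h).IsMinCostFlow (shiftCost c none (-lam - c none)) f ∧ f none = v := by
  obtain ⟨f, π, hf, hlam, hcs⟩ := hopt
  refine ⟨fun o => o.elim v f, isMinCostFlow_of_reducedCost _
    (isFlow_close h hf ⟨hv.1.le, hv.2.le⟩) π ?_ ?_, rfl⟩
  all_goals
    rintro (_ | e) he
    · simp [reducedCost, close, shiftCost] at he
      linarith
  · refine (hcs e).1 ?_
    simpa [reducedCost, close, shiftCost] using he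
  · refine (hcs e).2 ?_
    simpa [reducedCost, close, shiftCost] using he

/-- The spanning tree structure of the closed network given by a maximum flow of the gadget. -/
def startStructure (F : ℝ) (T U : Set E) (f : E → ℝ) : TreeStructure (Option E) where
  T := {o | o.elim True (· ∈ T)}
  L := {o | o.elim False fun e => e ∉ T ∧ e ∉ U}
  U := {o | o.elim False (· ∈ U)}
  flow o := o.elim F f

theorem isSpanningTreeStructure_startStructure (h : N.IsGadget ε b F K) {T U : Set E}
    {side : V → Prop} {f : E → ℝ} (hm : N.IsMaxStructure F T U side f) :
    (N.close h).IsSpanningTreeStructure (startStructure F T U f) where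
  cover := by
    ext (_ | e)
    · simp [startStructure]
    · simp only [startStructure, Set.mem_union, Set.mem_ofPred_eq, Option.elim_some, Set.mem_univ,
        iff_true]
      tauto
  disjoint_TL := by
    rw [Set.disjoint_left]
    rintro (_ | e) h1 h2
    · exact h2
    · exact h2.1 h1
  disjoint_TU := by
    rw [Set.disjoint_left]
    rintro (_ | e) h1 h2
    · exact h2
    · exact Set.disjoint_left.1 hm.disjoint h1 h2
  disjoint_LU := by
    rw [Set.disjoint_left]
    rintro (_ | e) h1 h2
    · exact h2
    · exact h1.2 h2
  isTree := by
    rw [isTree_iff _ N.s]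
    refine ⟨fun π hπ => N.connected_of_isForest hm.forest (fun e he => hπ (some e) he)
      (hπ none trivial), ?_⟩
    have : (startStructure F T U f).T = insert none (some '' T) := by
      ext (_ | e) <;> simp [startStructure]
    rw [this, Set.ncard_insert_of_notMem (by simp), Set.ncard_image_of_injective _
      (Option.some_injective E)]
    exact hm.forest.card
  isFlow := isFlow_close h hm.flow ⟨h.value_pos.le, le_rfl⟩
  flow_L := by
    rintro (_ | e) he
    · exact he.elim
    · exact (hm.lower e he.1 he.2).2.2
  flow_U := by
    rintro (_ | e) he
    · exact he.elim
    · exact (hm.upper e he).2.2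

/-- If the return edge is cheap enough, then the maximum flow is optimal. -/
theorem exists_isFinal_startStructure (h : N.IsGadget ε b F K) {T U : Set E}
    {side : V → Prop} {f : E → ℝ} (hm : N.IsMaxStructure F T U side f) (c : Option E → ℝ) (r : V) :
    ∃ y ≤ 0, (N.close h).IsFinal (shiftCost c none y) r (startStructure F T U f) := by
  classical
  obtain ⟨π, hπ0, hπ⟩ := (N.close h).exists_treePotential
    (isSpanningTreeStructure_startStructure h hm).isTree c r
  set M := ∑ o, |(N.close h).reducedCost c π o| with hM
  have hle : ∀ o, |(N.close h).reducedCost c π o| ≤ M := fun o =>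
    Finset.single_le_sum (f := fun o => |(N.close h).reducedCost c π o|)
      (fun _ _ => abs_nonneg _) (Finset.mem_univ o)
  have hM0 : 0 ≤ M := Finset.sum_nonneg fun _ _ => abs_nonneg _
  -- Lowering the sink side by `M` pushes the reduced costs of the edges across the cut in the
  -- directions demanded by `upper` and `lower`, and `M` dominates all old reduced costs.
  let ρ : V → ℝ := fun v => if side v then 0 else 1
  have hred : ∀ e, (N.close h).reducedCost (shiftCost c none (-M))
      (fun v => π v - M * (ρ v - ρ r)) (some e) =
      (N.close h).reducedCost c π (some e) + M * (ρ (N.src e) - ρ (N.tgt e)) := by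
    intro e
    simp only [reducedCost, shiftCost, close, Option.elim_some, reduceCtorEq, if_false]
    ring
  refine ⟨-M, by linarith, fun v => π v - M * (ρ v - ρ r), ⟨by simp [hπ0], ?_⟩, ?_⟩
  · rintro (_ | e) he
    · have h1 := hπ none he
      simp only [reducedCost, close, Option.elim_none, shiftCost, if_true] at h1 ⊢
      have h2 : ρ N.s = 0 := if_pos hm.forest.side_s
      have h3 : ρ N.t = 1 := if_neg hm.forest.side_t
      rw [h2, h3]
      linarith
    · rw [hred, hπ (some e) he]
      have : ρ (N.src e) = ρ (N.tgt e) := by simp only [ρ, hm.forest.side_iff e he]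
      rw [this]
      ring
  · rintro (_ | e) (⟨he, hv⟩ | ⟨he, hv⟩)
    · exact he
    · exact he
    · rw [hred] at hv
      obtain ⟨h1, h2, -⟩ := hm.lower e he.1 he.2
      have h3 : ρ (N.src e) = 1 := if_neg h1
      have h4 : ρ (N.tgt e) = 0 := if_pos h2
      rw [h3, h4] at hv
      linarith [neg_abs_le ((N.close h).reducedCost c π (some e)), hle (some e)]
    · rw [hred] at hv
      obtain ⟨h1, h2, -⟩ := hm.upper e he
      have h3 : ρ (N.src e) = 0 := if_pos h1
      have h4 : ρ (N.tgt e) = 1 := if_neg h2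
      rw [h3, h4] at hv
      linarith [le_abs_self ((N.close h).reducedCost c π (some e)), hle (some e)]

theorem needsNondegenerate_close (h : N.IsGadget ε b F K) {T U : Set E}
    {side : V → Prop} {f : E → ℝ} (hm : N.IsMaxStructure F T U side f)
    {leave : Set (Option E) → Option E} (hleave : ∀ A : Set (Option E), A.Nonempty → leave A ∈ A)
    {c : Option E → ℝ} (hc : IntIndependent c) (hpos : ∀ o, 0 < c o)
    (hlo : ∀ e, N.lo e ≤ c (some e) ∧ c (some e) ≤ N.lo e + ε) (r : V) :
    (N.close h).NeedsNondegenerate c r leave (startStructure F T U f) (K / 2) := by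
  have hc' : IntIndependent fun e => c (some e) := by
    intro d hd
    have := hc (fun o => o.elim 0 d) (by simpa [Fintype.sum_option] using hd)
    ext e
    exact congrFun this (some e)
  obtain ⟨ι, hι, lam, v, hK, hlam, hv, hopt⟩ := h.family _ hlo hc'
  choose g hg hgv using fun i => isMinCostFlow_close h (hopt i).2.1 (hopt i).2.2
  obtain ⟨y, hy, hfin⟩ := exists_isFinal_startStructure h hm c r
  have hgv' : (fun i => g i none) = v := funext hgv
  have := needsNondegenerate_of_family _ (fun _ => rfl) hc hpos hleave
    (isSpanningTreeStructure_startStructure h hm) hy hfin hg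
    (fun i j hij => hlam (by linarith)) (by rw [hgv']; exact hv)
    fun i => (hgv i).trans_lt (hopt i).2.1.2
  rwa [hK] at this

end TwoTerminalNet

/-! ### Costs -/

/-- The density of the uniform distribution on an interval of length `φ⁻¹`. -/
def uniformDensity (φ a x : ℝ) : ℝ := (Set.Icc a (a + φ⁻¹)).indicator (fun _ => φ) x

theorem isCostDensity_uniformDensity {φ a : ℝ} (hφ : 0 < φ) (ha : 0 ≤ a) (ha' : a + φ⁻¹ ≤ 1) :
    IsCostDensity φ (uniformDensity φ a) where
  measurable := measurable_const.indicator measurableSet_Icc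
  nonneg := Set.indicator_nonneg fun _ _ => hφ.le
  le x := Set.indicator_apply_le' (fun _ => le_rfl) fun _ => hφ.le
  eq_zero x hx := Set.indicator_of_notMem (fun h => hx ⟨ha.trans h.1, h.2.trans ha'⟩) _
  lintegral_eq_one := by
    have : (fun x => ENNReal.ofReal (uniformDensity φ a x)) =
        (Set.Icc a (a + φ⁻¹)).indicator fun _ => ENNReal.ofReal φ := by
      ext x
      by_cases hx : x ∈ Set.Icc a (a + φ⁻¹) <;> simp [uniformDensity, hx]
    rw [this, lintegral_indicator measurableSet_Icc, setLIntegral_const, Real.volume_Icc,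
      add_sub_cancel_left, ← ENNReal.ofReal_mul hφ.le, mul_inv_cancel₀ hφ.ne', ENNReal.ofReal_one]

section costLaw

variable {E : Type} [Fintype E] {φ : ℝ} {g : E → ℝ → ℝ}

theorem isProbabilityMeasure_withDensity {g : ℝ → ℝ} (hg : IsCostDensity φ g) :
    IsProbabilityMeasure (volume.withDensity fun x => ENNReal.ofReal (g x)) :=
  ⟨by rw [withDensity_apply _ MeasurableSet.univ, Measure.restrict_univ, hg.lintegral_eq_one]⟩

/-- For uniform densities this places every cost in its prescribed interval. -/
theorem ae_costLaw_ne_zero (hg : ∀ e, IsCostDensity φ (g e)) :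
    ∀ᵐ c ∂(costLaw g), ∀ e, g e (c e) ≠ 0 := by
  have := fun e => isProbabilityMeasure_withDensity (hg e)
  rw [ae_all_iff]
  intro e
  have h : ∀ᵐ x ∂(volume.withDensity fun x => ENNReal.ofReal (g e x)), g e x ≠ 0 := by
    rw [ae_withDensity_iff (hg e).measurable.ennreal_ofReal]
    refine Filter.Eventually.of_forall fun x hx h0 => hx (by simp [h0])
  exact (Measure.tendsto_eval_ae_ae
    (μ := fun e => volume.withDensity fun x => ENNReal.ofReal (g e x)) (i := e)).eventually h

/-- There are countably many integer vectors. For a nonzero one, the hyperplane meets each line in a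
direction `e` with `d e ≠ 0` in at most one point, so integrating over that coordinate first gives
measure zero. -/
theorem ae_costLaw_intIndependent (hg : ∀ e, IsCostDensity φ (g e)) :
    ∀ᵐ c ∂(costLaw g), IntIndependent c := by
  classical
  have := fun e => isProbabilityMeasure_withDensity (hg e)
  unfold IntIndependent
  rw [ae_all_iff]
  intro d
  by_cases hd : d = 0
  · exact Filter.Eventually.of_forall fun _ _ => hd
  obtain ⟨e, he⟩ := Function.ne_iff.1 hd
  have he' : (d e : ℝ) ≠ 0 := by exact_mod_cast he
  set A : Set (E → ℝ) := {c | ∑ a, (d a : ℝ) * c a = 0} with hA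
  have hAm : MeasurableSet A :=
    (isClosed_eq (by fun_prop) continuous_const).measurableSet
  have h0 : costLaw g A = 0 := by
    have hf : Measurable (A.indicator (1 : (E → ℝ) → ENNReal)) := measurable_one.indicator hAm
    rw [← lintegral_indicator_one hAm, costLaw, lintegral_eq_lmarginal_univ 0,
      lmarginal_erase' _ hf (Finset.mem_univ e)]
    have : (fun x : E → ℝ => ∫⁻ t, A.indicator (1 : (E → ℝ) → ENNReal) (Function.update x e t)
        ∂(volume.withDensity fun x => ENNReal.ofReal (g e x))) = 0 := by
      ext x
      have hsub : {t | Function.update x e t ∈ A}.Subsingleton := by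
        intro t ht t' ht'
        simp only [hA, Set.mem_ofPred_eq, Function.update_apply, mul_ite] at ht ht'
        rw [← Finset.add_sum_erase _ _ (Finset.mem_univ e)] at ht ht'
        rw [if_pos rfl] at ht ht'
        rw [Finset.sum_congr rfl fun a ha => if_neg (Finset.ne_of_mem_erase ha)] at ht ht'
        exact mul_left_cancel₀ he' (by linarith)
      have hm : MeasurableSet {t | Function.update x e t ∈ A} := measurable_update x hAm
      have : (fun t => A.indicator (1 : (E → ℝ) → ENNReal) (Function.update x e t)) =
          {t | Function.update x e t ∈ A}.indicator 1 := rfl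
      rw [this, lintegral_indicator_one hm]
      exact hsub.measure_zero _
    rw [this]
    simp [lmarginal]
  filter_upwards [measure_eq_zero_iff_ae_notMem.1 h0] with c hc h
  exact absurd h hc

end costLaw

/-! ### The parameters -/

/-- Number of edges of the paths added in the `i`-th doubling. -/
def pathLength (φ : ℝ) (i : ℕ) : ℕ := ⌈16 * 2 ^ i / φ⌉₊

/-- Upper bound for the path costs after `i` doublings. -/
def costBound (φ : ℝ) (i : ℕ) : ℝ := (2 ^ i * (8 + 16 * i / φ) - 4) / φ

theorem costBound_nonneg {φ : ℝ} (hφ : 0 < φ) (i : ℕ) : 0 ≤ costBound φ i := by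
  have h1 : (1 : ℝ) ≤ 2 ^ i := one_le_pow₀ (by norm_num)
  have h2 : (0 : ℝ) ≤ 16 * i / φ := by positivity
  refine div_nonneg ?_ hφ.le
  nlinarith

theorem pathLength_pos {φ : ℝ} (hφ : 0 < φ) (i : ℕ) : 0 < pathLength φ i :=
  Nat.ceil_pos.2 (by positivity)

/-- `costBound` solves this recursion with equality once `pathLength` is replaced by its bound `16 *
2 ^ i / φ + 1`. The term `16 * i / φ` collects the random parts of the path costs, and the `-4`
absorbs the constants. -/
theorem costBound_succ {φ : ℝ} (hφ : 0 < φ) (i : ℕ) :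
    2 * (costBound φ i + φ⁻¹ + pathLength φ i * φ⁻¹) ≤ costBound φ (i + 1) := by
  have h : (pathLength φ i : ℝ) ≤ 16 * 2 ^ i / φ + 1 := (Nat.ceil_lt_add_one (by positivity)).le
  have e1 : 2 * (costBound φ i + φ⁻¹ + pathLength φ i * φ⁻¹) =
      (2 * (2 ^ i * (8 + 16 * i / φ) - 4 + 1 + pathLength φ i)) / φ := by
    unfold costBound
    field_simp
  have e2 : (2 : ℝ) ^ (i + 1) * (8 + 16 * ((i + 1 : ℕ) : ℝ) / φ) - 4 =
      2 * (2 ^ i * (8 + 16 * i / φ) - 4 + 1 + (16 * 2 ^ i / φ + 1)) := by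
    push_cast
    field_simp
    ring
  rw [e1, costBound, e2]
  gcongr

theorem edgeCost_le {φ : ℝ} (hφ : 16 / 7 ≤ φ) {i : ℕ} (hi : 16 * (i : ℝ) ≤ φ) :
    (costBound φ i + φ⁻¹) / pathLength φ i + φ⁻¹ ≤ 1 := by
  have hφ0 : 0 < φ := by linarith
  have hl : 16 * 2 ^ i / φ ≤ (pathLength φ i : ℝ) := Nat.le_ceil _
  have hl0 : (0 : ℝ) < pathLength φ i := by exact_mod_cast pathLength_pos hφ0 i
  have h1 : 16 * (i : ℝ) / φ ≤ 1 := (div_le_one hφ0).2 hi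
  have h2 : φ⁻¹ ≤ 7 / 16 := by
    rw [inv_le_comm₀ hφ0 (by norm_num)]
    linarith
  have h3 : costBound φ i + φ⁻¹ ≤ 9 * 2 ^ i / φ := by
    have : costBound φ i + φ⁻¹ = (2 ^ i * (8 + 16 * i / φ) - 4 + 1) / φ := by
      unfold costBound
      field_simp
    rw [this]
    have : (0 : ℝ) < 2 ^ i := by positivity
    gcongr
    nlinarith
  -- The lower bounds take at most `9 / 16`, which leaves `7 / 16` for the interval length `φ⁻¹`.
  have h4 : (costBound φ i + φ⁻¹) / pathLength φ i ≤ 9 / 16 := by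
    rw [div_le_iff₀ hl0]
    have : 9 * 2 ^ i / φ = 9 / 16 * (16 * 2 ^ i / φ) := by ring
    linarith
  linarith

theorem exists_isGadget {n m : ℕ} (hm : 0 < m) (hmn : m ≤ n ^ 2) {φ : ℝ} (hφ : 1 ≤ φ) (D : ℕ)
    (hD : ∀ i < D, 16 / 7 ≤ φ ∧ 16 * (i : ℝ) ≤ φ) :
    ∃ (V E : Type) (_ : Fintype V) (_ : Fintype E) (N : TwoTerminalNet V E),
      N.IsGadget φ⁻¹ (costBound φ D) (2 ^ D * m) (2 ^ D * m) ∧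
      n ≤ Fintype.card V ∧ (Fintype.card V : ℝ) ≤ 2 * n + 2 + 2 * (16 * 2 ^ D / φ + D) ∧
      m ≤ Fintype.card E ∧ (Fintype.card E : ℝ) ≤ 2 * n + m + 4 * (16 * 2 ^ D / φ + D) := by
  have hφ0 : 0 < φ := by linarith
  induction D with
  | zero =>
    have hn : 0 < n := by
      rcases Nat.eq_zero_or_pos n with rfl | h
      · simp at hmn
        omega
      · exact h
    have hlt : ∀ e : Fin m, (e : ℕ) / n < n := fun e => by
      rw [Nat.div_lt_iff_lt_mul hn]
      exact (e.2.trans_le hmn).trans_eq (sq n)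
    -- Quotient and remainder modulo `n` enumerate distinct pairs, as `m ≤ n ^ 2`.
    let u : Fin m → Fin n := fun e => ⟨e / n, hlt e⟩
    let w : Fin m → Fin n := fun e => ⟨e % n, Nat.mod_lt _ hn⟩
    have huw : Function.Injective fun e => (u e, w e) := by
      intro e e' h
      have h1 : (e : ℕ) / n = e' / n := congrArg (fun x => (x.1 : ℕ)) h
      have h2 : (e : ℕ) % n = e' % n := congrArg (fun x => (x.2 : ℕ)) h
      ext
      rw [← Nat.div_add_mod e n, ← Nat.div_add_mod e' n, h1, h2]
    have hg := TwoTerminalNet.base_isGadget hm huw (inv_pos.2 hφ0) (inv_le_one_of_one_le₀ hφ)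
    have hpos : 0 ≤ 16 / φ := by positivity
    refine ⟨_, _, inferInstance, inferInstance, TwoTerminalNet.base n m u w, ?_, ?_, ?_, ?_, ?_⟩
    · have e1 : costBound φ 0 = 4 * φ⁻¹ := by
        unfold costBound
        norm_num
        field_simp
      rw [e1]
      simpa using hg
    · simp
      omega
    · simp
      linarith
    · simp
    · simp
      linarith
  | succ D ih =>
    obtain ⟨V, E, hV, hE, N, hN, h1, h2, h3, h4⟩ := ih fun i hi => hD i (by omega)
    obtain ⟨hφ', hDφ⟩ := hD D (by omega)
    obtain ⟨p, hp⟩ : ∃ p, pathLength φ D = p + 1 :=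
      ⟨_, (Nat.succ_pred_eq_of_pos (pathLength_pos hφ0 D)).symm⟩
    have hl : (pathLength φ D : ℝ) ≤ 16 * 2 ^ D / φ + 1 :=
      (Nat.ceil_lt_add_one (by positivity)).le
    have hlo := edgeCost_le hφ' hDφ
    have hb := costBound_succ hφ0 D
    rw [hp] at hl hlo hb
    -- `δ` is chosen smallest possible, as the old price bound plus one interval length.
    have hg := hN.double N (p := p) (inv_pos.2 hφ0) (costBound_nonneg hφ0 D) le_rfl hlo
    have hg' := hg.mono _ hb
    have e1 : 16 * (2 : ℝ) ^ (D + 1) / φ = 16 * 2 ^ D / φ + 16 * 2 ^ D / φ := by ring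
    push_cast at hl
    refine ⟨_, _, inferInstance, inferInstance, N.double p (costBound φ D + φ⁻¹) (2 ^ D * m),
      ?_, ?_, ?_, ?_, ?_⟩
    · have e2 : (2 : ℝ) ^ (D + 1) * m = 2 * (2 ^ D * m) := by ring
      have e3 : 2 ^ (D + 1) * m = 2 * (2 ^ D * m) := by ring
      rw [e2, e3]
      exact hg'
    · simp
      omega
    · simp
      rw [e1]
      linarith
    · simp
      omega
    · simp
      rw [e1]
      linarith

theorem sq_le_four_mul_two_pow (i : ℕ) : i ^ 2 ≤ 4 * 2 ^ i := by
  rcases Nat.lt_or_ge i 4 with h | h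
  · interval_cases i <;> norm_num
  · have : i ^ 2 ≤ 2 ^ i := by
      induction i, h using Nat.le_induction with
      | base => norm_num
      | succ i hi ih =>
        rw [pow_succ 2 i]
        nlinarith
    omega

end

/-! ### Choice of the number of doublings and conclusion -/

theorem mainTheorem4 :
    ∃ α₁ α₂ β₁ β₂ κ : ℝ, 0 < α₁ ∧ 0 < α₂ ∧ 0 < β₁ ∧ 0 < β₂ ∧ 0 < κ ∧
      ∀ n m : ℕ, 1 ≤ n → n ≤ m → m ≤ n ^ 2 → ∀ φ : ℝ, 1 ≤ φ → φ ≤ 2 ^ n →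
        ∃ (V E : Type) (_ : Fintype V) (_ : Fintype E) (G : FlowNetwork V E) (g : E → ℝ → ℝ)
          (S₀ : TreeStructure E) (leave : Set E → E),
          (α₁ * n ≤ Fintype.card V ∧ (Fintype.card V : ℝ) ≤ α₂ * n) ∧
          (β₁ * m ≤ Fintype.card E ∧ (Fintype.card E : ℝ) ≤ β₂ * m) ∧
          (∀ e, IsCostDensity φ (g e)) ∧
          G.IsSpanningTreeStructure S₀ ∧
          (∀ A : Set E, A.Nonempty → leave A ∈ A) ∧
          ∀ᵐ c ∂(costLaw g), ∀ r : V,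
            G.NeedsNondegenerate c r leave S₀ (κ * (m * min (n : ℝ) φ * φ)) := by
  classical
  refine ⟨1, 40, 1, 76, 1 / 4096, by norm_num, by norm_num, by norm_num, by norm_num, by norm_num,
    fun n m hn hnm hmn φ hφ hφn => ?_⟩
  have hφ0 : 0 < φ := by linarith
  have hn' : (1 : ℝ) ≤ n := by exact_mod_cast hn
  have hnm' : (n : ℝ) ≤ m := by exact_mod_cast hnm
  set x : ℝ := φ * min (n : ℝ) φ / 1024 with hx
  have hx0 : 0 ≤ x := by positivity
  have hx1 : x ≤ φ * n / 1024 := by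
    rw [hx]
    gcongr
    exact min_le_left _ _
  have hx2 : x ≤ φ * φ / 1024 := by
    rw [hx]
    gcongr
    exact min_le_right _ _
  -- For `x < 1` this gives `D = 0`: the base gadget alone suffices, and the bound `2 ^ D ≤ x` is
  -- only available for `D ≠ 0`.
  set D := Nat.log 2 ⌊x⌋₊ with hDdef
  have hlow : x < 2 ^ (D + 1) := by
    have h1 : ⌊x⌋₊ < 2 ^ (D + 1) := Nat.lt_pow_succ_log_self (by norm_num) _
    have h2 : ((⌊x⌋₊ + 1 : ℕ) : ℝ) ≤ 2 ^ (D + 1) := by exact_mod_cast h1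
    push_cast at h2
    exact (Nat.lt_floor_add_one x).trans_le h2
  have hup : D ≠ 0 → (2 : ℝ) ^ D ≤ x := by
    intro hD
    have h0 : ⌊x⌋₊ ≠ 0 := by
      intro h
      rw [h] at hDdef
      exact hD (by simpa using hDdef)
    have h1 : 2 ^ D ≤ ⌊x⌋₊ := Nat.pow_log_le_self 2 h0
    have h2 : (2 : ℝ) ^ D ≤ (⌊x⌋₊ : ℝ) := by exact_mod_cast h1
    exact h2.trans (Nat.floor_le hx0)
  have hcond : ∀ i < D, 16 / 7 ≤ φ ∧ 16 * (i : ℝ) ≤ φ := by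
    intro i hi
    have h1 := (hup (by omega)).trans hx2
    have h2 : (2 : ℝ) ^ 1 ≤ 2 ^ D := pow_le_pow_right₀ (by norm_num) (by omega)
    have h3 : (2 : ℝ) ^ i ≤ 2 ^ D := pow_le_pow_right₀ (by norm_num) (by omega)
    have h4 : (i : ℝ) ^ 2 ≤ 4 * 2 ^ i := by exact_mod_cast sq_le_four_mul_two_pow i
    refine ⟨by nlinarith, ?_⟩
    -- `(16 * i) ^ 2 ≤ 256 * 4 * 2 ^ i ≤ 1024 * x ≤ φ ^ 2`; this is the source of the constant
    -- `1024`.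
    refine le_of_sq_le_sq ?_ hφ0.le
    nlinarith
  -- The only use of `φ ≤ 2 ^ n`: rounding up the path lengths costs an additive `O(D)`, which must
  -- remain `O(n)`.
  have hDn : D ≤ 2 * n := by
    by_contra! h
    have h1 := (hup (by omega)).trans hx1
    have h2 : (2 : ℝ) ^ (2 * n) ≤ 2 ^ D := pow_le_pow_right₀ (by norm_num) (by omega)
    have h3 : (n : ℝ) < 2 ^ n := by exact_mod_cast Nat.lt_two_pow_self
    have h4 : (2 : ℝ) ^ (2 * n) = 2 ^ n * 2 ^ n := by ring
    have h5 : φ * n ≤ 2 ^ n * 2 ^ n := by gcongr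
    have h6 : (0 : ℝ) < 2 ^ n * 2 ^ n := by positivity
    linarith
  have hDn' : (D : ℝ) ≤ 2 * n := by exact_mod_cast hDn
  have hpow : 16 * (2 : ℝ) ^ D / φ ≤ 16 * n := by
    rw [div_le_iff₀ hφ0]
    rcases eq_or_ne D 0 with h | h
    · rw [h]
      nlinarith
    · have := (hup h).trans hx1
      nlinarith
  obtain ⟨V, E, hV, hE, N, hN, h1, h2, h3, h4⟩ :=
    exists_isGadget (by omega) hmn hφ D hcond
  obtain ⟨T, U, side, f, hmax⟩ := hN.max_structure
  have h1' : (n : ℝ) ≤ Fintype.card V := by exact_mod_cast h1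
  have h3' : (m : ℝ) ≤ Fintype.card E := by exact_mod_cast h3
  let lo : Option E → ℝ := fun o => o.elim 0 N.lo
  have hlo0 : ∀ o, 0 ≤ lo o := by
    rintro (_ | e)
    · exact le_rfl
    · exact hN.lo_nonneg e
  have hg : ∀ o, IsCostDensity φ (uniformDensity φ (lo o)) := by
    intro o
    refine isCostDensity_uniformDensity hφ0 (hlo0 o) ?_
    rcases o with _ | e
    · simpa [lo] using inv_le_one_of_one_le₀ hφ
    · exact hN.lo_le e
  let leave : Set (Option E) → Option E := fun A => if h : A.Nonempty then h.some else none
  have hleave : ∀ A : Set (Option E), A.Nonempty → leave A ∈ A := fun A hA => by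
    simp only [leave, dif_pos hA]
    exact hA.some_mem
  refine ⟨V, Option E, hV, inferInstance, N.close hN, fun o => uniformDensity φ (lo o),
    TwoTerminalNet.startStructure _ T U f, leave, ⟨by linarith, by linarith⟩,
    ⟨by rw [Fintype.card_option]; push_cast; linarith, by rw [Fintype.card_option]; push_cast; linarith⟩,
    hg, TwoTerminalNet.isSpanningTreeStructure_startStructure hN hmax, hleave, ?_⟩
  filter_upwards [ae_costLaw_ne_zero hg, ae_costLaw_intIndependent hg] with c hc hi r
  have hmem : ∀ o, c o ∈ Set.Icc (lo o) (lo o + φ⁻¹) := fun o =>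
    Set.mem_of_indicator_ne_zero (hc o)
  have hpos : ∀ o, 0 < c o := fun o =>
    lt_of_le_of_ne ((hlo0 o).trans (hmem o).1) (hi.ne_zero o).symm
  obtain ⟨k1, k2⟩ := TwoTerminalNet.needsNondegenerate_close hN hmax hleave hi hpos
    (fun e => hmem (some e)) r
  refine ⟨k1, fun M S' hex hst => ⟨(k2 M S' hex hst).1, le_trans ?_ (k2 M S' hex hst).2⟩⟩
  -- Half of the `2 ^ D * m` values is at least `m * x / 4`, because `x < 2 ^ (D + 1)`; and `4096 =
  -- 4 * 1024`.
  have e1 : 1 / 4096 * (m * min (n : ℝ) φ * φ) = m * x / 4 := by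
    rw [hx]
    ring
  have e2 : ((2 ^ D * m : ℕ) : ℝ) / 2 = m * 2 ^ (D + 1) / 4 := by
    push_cast
    ring
  rw [e1, e2]
  gcongr
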